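/- For $z,\mu$ in the open unit disk $\mathbb D$ let $[z,\mu]_{\rm h}=\left|\frac{z-\mu}{1-\bar\mu z}\right|$. Let $\mathcal D\subset\mathbb D$ be compact, and put $$\tau_q(\mathcal D)=\min_{\mu_1,\dots,\mu_q\in\mathcal D}\ \max_{z\in\mathcal D}\Big(\prod_{k=1}^q[z,\mu_k]_{\rm h}\Big)^{1/q},\qquad \tau(\mathcal D)=\lim_{q\to\infty}\tau_q(\mathcal D).$$ Throughout, $\|\cdot\|$ is the Euclidean norm of a vector and the Frobenius norm of a matrix, and $\|F\|_2=\big(\frac1{2\pi}\int_{-\pi}^{\pi}\|F(e^{i\omega})\|^2d\omega\big)^{1/2}$ for a stable transfer function $F$. **Setting.** *True system.* $G(z)=\sum_{j=1}^n\frac{R_j}{z-\lambda_j}=\sum_{l\ge1}H_lz^{-l}$ with $R_j\in\mathbb C^{p\times m}$, distinct poles $\lambda_j\in\mathcal D$, and real Markov parameters $H_l$. Put $\bar R=\sum_j\|R_j\|$ and $\rho_\lambda=\max_j|\lambda_j|$. *Surrogate.* $\mu_1,\dots,\mu_n\in\mathcal D$ is a minimizer of $\max_{\lambda\in\partial\mathcal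 D}\prod_{k=1}^n[\lambda,\mu_k]_{\rm h}$ over $\mathcal D^n$, and $\check G(z)=\sum_{k=1}^n\check R_kV_k(z)$, where $\check R_k\in\mathbb C^{p\times m}$ minimize $\|G-\check G\|_2$. Here $V_k(z)=\frac1{z-\mu_k}$ if the $\mu_k$ are distinct; alternatively (also when poles are repeated) $V_k(z)=\frac{\sqrt{1-|\mu_k|^2}}{z-\mu_k}\prod_{l<k}\frac{1-\bar\mu_lz}{z-\mu_l}$. Let $\check H_l$ be the real parts of the Markov parameters of $\check G$ (they are the Markov parameters themselves whenever $\check G$ is a real system). *Signals.* The noise $v_t$ is i.i.d. $\mathcal N(0,\mathcal R)$ in $\mathbb R^p$ with $\mathcal R\succ0$. Inputs before time $0$ vanish, so the outputs are $y_t=\sum_{l=1}^tH_lu_{t-l}+v_t$ under $\mathcal H_0$ (true system) and $y_t=\sum_{l=1}^t\check H_lu_{t-l}+v_t$ under $\mathcal H_1$ (surrogate). Under both hypotheses the input is generated by the same causal linear controller $u_t=\sum_{s=1}^tK_{t-s}y_s+w_t$, where the process $w$ is independent of $(v_t)_{t\ge1}$ (open loop is the case $K=0$). Under $\mathcal H_0$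 the input is square integrable and (wide-sense) stationary with power spectral density $\Phi_u(\omega)=\sum_{k\in\mathbb Z}\mathbb E(u_tu_{t-k}^\top)e^{ik\omega}$ (as a Fourier series) and $\operatorname{ess\,sup}_\omega\|\Phi_u(\omega)\|<\infty$. Let $\mathbb P_0,\mathbb P_1$ be the conditional distributions of $(y_1,\dots,y_N)$ given $(u_0,\dots,u_{N-1})$ under $\mathcal H_0,\mathcal H_1$, and let $\mathbb E D_{\rm KL}(\mathbb P_0\|\mathbb P_1)$ be the expectation over the input $u$ (under $\mathcal H_0$) of the Kullback–Leibler divergence. **Theorem.** 1. For every $N$, $$\mathbb E D_{\rm KL}(\mathbb P_0\|\mathbb P_1)\le\frac{\bar R^2\,\|\mathcal R^{-1}\|\operatorname{ess\,sup}_\omega\|\Phi_u(\omega)\|}{2(1-\rho_\lambda^2)}\,\tau_n(\mathcal D)^{2n}N .$$ 2. If $\delta>0$ and $\mathbb E D_{\rm KL}(\mathbb P_0\|\mathbb P_1)\ge\delta$, then $$N\ge\frac{2\delta(1-\rho_\lambda^2)}{\bar R^2\,\|\mathcal R^{-1}\|\operatorname{ess\,sup}_\omega\|\Phi_u(\omega)\|}\,\tau_n(\mathcal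 D)^{-2n}.$$ 3. Let, for each $n$, a setting as above with $n$ poles in the same $\mathcal D$ be given, such that $\kappa_n=\bar R^2\|\mathcal R^{-1}\|\operatorname{ess\,sup}_\omega\|\Phi_u(\omega)\|$ does not grow exponentially in $n$ (for every $r>1$, $\kappa_n\le r^n$ for all large $n$; for instance, $\kappa_n$ is bounded). If $\delta>0$ and the sample sizes $N_n$ satisfy $\mathbb E D_{\rm KL}(\mathbb P_0\|\mathbb P_1)\ge\delta$ for all large $n$, then $$\liminf_{n\to\infty}N_n^{1/(2n)}\ge\tau(\mathcal D)^{-1}\qquad(\text{with }0^{-1}=\infty).$$ -/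

import Mathlib

open MeasureTheory ProbabilityTheory InformationTheory Filter Topology
open scoped ENNReal Matrix

universe u

noncomputable section

namespace OBF

/-! ### Hyperbolic Chebyshev constants -/

/-- The pseudohyperbolic distance `[z, μ]_h = |(z - μ) / (1 - conj μ * z)|`. -/
def pdist (z μ : ℂ) : ℝ := ‖(z - μ) / (1 - (starRingEnd ℂ) μ * z)‖

/-- The finite hyperbolic Chebyshev constant
`τ_q(D) = min_{μ₁, …, μ_q ∈ D} max_{z ∈ D} (∏ₖ [z, μₖ]_h)^(1/q)`. -/
def chebyshevFin (D : Set ℂ) (q : ℕ) : ℝ :=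
  ⨅ μ : Fin q → D, ⨆ z : D, (∏ k, pdist z (μ k)) ^ (1 / (q : ℝ))

/-- The hyperbolic Chebyshev constant `τ(D) = lim_{q → ∞} τ_q(D)`. -/
def chebyshev (D : Set ℂ) : ℝ := limUnder atTop (chebyshevFin D)

/-- The objective of the minimax pole selection problem, `max_{z ∈ ∂D} ∏ₖ [z, μₖ]_h`. -/
def minimaxObjective (D : Set ℂ) {q : ℕ} (μ : Fin q → ℂ) : ℝ :=
  ⨆ z : frontier D, ∏ k, pdist z (μ k)

/-- `μ₁, …, μ_q` is a minimizer of the minimax pole selection problem over `D`. -/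
def IsMinimaxPoles (D : Set ℂ) {q : ℕ} (μ : Fin q → ℂ) : Prop :=
  (∀ k, μ k ∈ D) ∧
    ∀ ν : Fin q → ℂ, (∀ k, ν k ∈ D) → minimaxObjective D μ ≤ minimaxObjective D ν

/-! ### Transfer functions -/

/-- The Frobenius norm of a real or complex matrix. -/
def frobNorm {𝕜 : Type*} [RCLike 𝕜] {p m : ℕ} (A : Matrix (Fin p) (Fin m) 𝕜) : ℝ :=
  Real.sqrt (∑ i, ∑ j, ‖A i j‖ ^ 2)

/-- The basis functions `V_k(z) = 1 / (z - μₖ)`. -/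
def simpleBasis {q : ℕ} (μ : Fin q → ℂ) (k : Fin q) (z : ℂ) : ℂ := 1 / (z - μ k)

/-- The orthonormal basis functions
`𝒱_k(z) = √(1 - |μₖ|²) / (z - μₖ) * ∏_{l < k} (1 - conj μ_l * z) / (z - μ_l)`. -/
def orthoBasis {q : ℕ} (μ : Fin q → ℂ) (k : Fin q) (z : ℂ) : ℂ :=
  (Real.sqrt (1 - ‖μ k‖ ^ 2) : ℂ) / (z - μ k) *
    ∏ l ∈ Finset.univ.filter (fun l => l < k), (1 - (starRingEnd ℂ) (μ l) * z) / (z - μ l)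

/-- `V` is a system of basis functions with poles `μ₁, …, μ_q`: the functions `1 / (z - μₖ)` if
the poles are distinct, or (for arbitrary, possibly repeated poles) the orthonormal functions
`𝒱_k`, which have the same span when the poles are distinct. -/
def IsBasisFor {q : ℕ} (μ : Fin q → ℂ) (V : Fin q → ℂ → ℂ) : Prop :=
  (Function.Injective μ ∧ V = simpleBasis μ) ∨ V = orthoBasis μ

/-- The transfer function `z ↦ ∑ₖ V_k(z) Rₖ`. -/
def transferFn {n p m : ℕ} (V : Fin n → ℂ → ℂ) (R : Fin n → Matrix (Fin p) (Fin m) ℂ) (z : ℂ) :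
    Matrix (Fin p) (Fin m) ℂ :=
  ∑ k, V k z • R k

/-- The Markov parameter `H_l` in the expansion `F(z) = H_1 z⁻¹ + H_2 z⁻² + ⋯` (on `1 ≤ |z|`) of a
strictly stable, strictly proper transfer function, as a Fourier coefficient on the unit circle. -/
def markov {p m : ℕ} (F : ℂ → Matrix (Fin p) (Fin m) ℂ) (l : ℕ) : Matrix (Fin p) (Fin m) ℂ :=
  Matrix.of fun i j => ((2 * Real.pi : ℝ) : ℂ)⁻¹ *
    ∫ ω in (-Real.pi)..Real.pi,
      F (Complex.exp (ω * Complex.I)) i j * Complex.exp (l * ω * Complex.I)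

/-- The real part of the Markov parameters; for a system that maps real signals to real signals
this is the sequence of Markov parameters itself. -/
def realMarkov {p m : ℕ} (F : ℂ → Matrix (Fin p) (Fin m) ℂ) (l : ℕ) :
    Matrix (Fin p) (Fin m) ℝ :=
  (markov F l).map Complex.re

/-- The `H₂` norm `((2π)⁻¹ ∫ ‖F(e^{iω})‖_F² dω)^{1/2}` of a stable transfer function. -/
def h2Norm {p m : ℕ} (F : ℂ → Matrix (Fin p) (Fin m) ℂ) : ℝ :=
  Real.sqrt ((2 * Real.pi)⁻¹ *
    ∫ ω in (-Real.pi)..Real.pi, frobNorm (F (Complex.exp (ω * Complex.I))) ^ 2)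

/-- `Ř₁, …, Ř_q` minimizes `‖G - ∑ₖ Řₖ V_k‖₂`. -/
def IsH2Optimal {p m q : ℕ} (G : ℂ → Matrix (Fin p) (Fin m) ℂ) (V : Fin q → ℂ → ℂ)
    (R' : Fin q → Matrix (Fin p) (Fin m) ℂ) : Prop :=
  ∀ S : Fin q → Matrix (Fin p) (Fin m) ℂ,
    h2Norm (fun z => G z - transferFn V R' z) ≤ h2Norm (fun z => G z - transferFn V S z)

/-! ### Signals -/

/-- A real matrix acting on a Euclidean vector. -/
def act {p m : ℕ} (A : Matrix (Fin p) (Fin m) ℝ) (x : EuclideanSpace ℝ (Fin m)) :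
    EuclideanSpace ℝ (Fin p) :=
  WithLp.toLp 2 (A *ᵥ x.ofLp)

/-- The output `y_t = ∑_{l=1}^t H_l u_{t-l} + v_t` of a strictly causal system at rest before
time `0`. -/
def output {Ω : Type*} {p m : ℕ} (H : ℕ → Matrix (Fin p) (Fin m) ℝ)
    (u : ℕ → Ω → EuclideanSpace ℝ (Fin m)) (v : ℕ → Ω → EuclideanSpace ℝ (Fin p))
    (t : ℕ) (ω : Ω) : EuclideanSpace ℝ (Fin p) :=
  ∑ l ∈ Finset.Icc 1 t, act (H l) (u (t - l) ω) + v t ω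

/-- The input `u` is generated by a linear time-invariant causal controller with impulse response
`K`: `u_t = ∑_{s=1}^t K_{t-s} y_s + w_t`. The case `K = 0` is open loop. -/
def IsControlled {Ω : Type*} {p m : ℕ} (K : ℕ → Matrix (Fin m) (Fin p) ℝ)
    (w : ℕ → Ω → EuclideanSpace ℝ (Fin m)) (y : ℕ → Ω → EuclideanSpace ℝ (Fin p))
    (u : ℕ → Ω → EuclideanSpace ℝ (Fin m)) : Prop :=
  ∀ t ω, u t ω = ∑ s ∈ Finset.Icc 1 t, act (K (t - s)) (y s ω) + w t ω

/-- (Wide-sense) stationarity of a square-integrable process: `E u_{t+k} u_tᵀ` does not depend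
on `t`. -/
def IsStationary {Ω : Type*} [MeasurableSpace Ω] {m : ℕ} (P : Measure Ω)
    (u : ℕ → Ω → EuclideanSpace ℝ (Fin m)) : Prop :=
  (∀ t, MemLp (u t) 2 P) ∧
    ∀ t k i j, ∫ ω, u (t + k) ω i * u t ω j ∂P = ∫ ω, u k ω i * u 0 ω j ∂P

/-- The autocorrelation `R_u(k) = E u_t u_{t-k}ᵀ` of a stationary process, evaluated at the first
`t` for which both times are nonnegative. -/
def autocorr {Ω : Type*} [MeasurableSpace Ω] {m : ℕ} (P : Measure Ω)
    (u : ℕ → Ω → EuclideanSpace ℝ (Fin m)) (k : ℤ) : Matrix (Fin m) (Fin m) ℝ :=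
  Matrix.of fun i j => ∫ ω, u k.toNat ω i * u (-k).toNat ω j ∂P

/-- `Φ` is the power spectral density `Φ(ω) = ∑_{k ∈ ℤ} R(k) e^{ikω}` of the autocorrelation
sequence `R`: it is integrable over a period and `R(k)` are its Fourier coefficients. -/
def IsSpectralDensity {m : ℕ} (R : ℤ → Matrix (Fin m) (Fin m) ℝ)
    (Φ : ℝ → Matrix (Fin m) (Fin m) ℂ) : Prop :=
  (∀ i j, IntervalIntegrable (fun ω => Φ ω i j) volume (-Real.pi) Real.pi) ∧
    ∀ (k : ℤ) i j, ((2 * Real.pi : ℝ) : ℂ)⁻¹ *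
      (∫ ω in (-Real.pi)..Real.pi, Φ ω i j * Complex.exp (-(k * ω * Complex.I))) = (R k i j : ℂ)

/-- `ess sup_ω ‖Φ(ω)‖` over a period. -/
def essSupNorm {m : ℕ} (Φ : ℝ → Matrix (Fin m) (Fin m) ℂ) : ℝ≥0∞ :=
  essSup (fun ω => ENNReal.ofReal (frobNorm (Φ ω)))
    (volume.restrict (Set.Ioc (-Real.pi) Real.pi))

/-! ### The experiment -/

/-- A true system with `n` poles in `D`, its surrogate with minimax-optimal poles, and the random
signals that drive both of them. -/
structure Experiment (D : Set ℂ) (n p m : ℕ) where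
  /-- residues `Rⱼ` of the true system `G` -/
  R : Fin n → Matrix (Fin p) (Fin m) ℂ
  /-- poles `λⱼ` of the true system `G` -/
  pole : Fin n → ℂ
  pole_mem : ∀ j, pole j ∈ D
  pole_injective : Function.Injective pole
  /-- `G(z) = ∑ⱼ Rⱼ / (z - λⱼ)` maps real signals to real signals. -/
  real : ∀ l i j, (markov (transferFn (simpleBasis pole) R) l i j).im = 0
  /-- poles `μₖ` of the surrogate -/
  spole : Fin n → ℂ
  spole_minimax : IsMinimaxPoles D spole
  /-- basis functions of the surrogate -/
  V : Fin n → ℂ → ℂ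
  V_basis : IsBasisFor spole V
  /-- coefficients `Řₖ` of the surrogate `Ǧ = ∑ₖ Řₖ V_k` -/
  sR : Fin n → Matrix (Fin p) (Fin m) ℂ
  sR_optimal : IsH2Optimal (transferFn (simpleBasis pole) R) V sR
  /-- the probability space -/
  Ω : Type u
  mΩ : MeasurableSpace Ω
  P : Measure Ω
  isProb : IsProbabilityMeasure P
  /-- covariance matrix of the noise -/
  cov : Matrix (Fin p) (Fin p) ℝ
  cov_posDef : cov.PosDef
  /-- the noise `v_t` -/
  v : ℕ → Ω → EuclideanSpace ℝ (Fin p)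
  v_measurable : ∀ t, Measurable (v t)
  v_law : ∀ t, P.map (v t) = multivariateGaussian 0 cov
  v_indep : iIndepFun v P
  /-- impulse response of the controller -/
  K : ℕ → Matrix (Fin m) (Fin p) ℝ
  /-- the part of the input that is not feedback from the outputs `y_1, y_2, …` (external
  excitation, and feedback from outputs up to time `0`) -/
  w : ℕ → Ω → EuclideanSpace ℝ (Fin m)
  w_measurable : ∀ t, Measurable (w t)
  w_indep : IndepFun (fun ω t => w t ω) (fun ω t => v (t + 1) ω) P
  /-- the input when the plant is the true system -/
  u : ℕ → Ω → EuclideanSpace ℝ (Fin m)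
  u_controlled : IsControlled K w (output (realMarkov (transferFn (simpleBasis pole) R)) u v) u
  /-- the input when the plant is the surrogate -/
  su : ℕ → Ω → EuclideanSpace ℝ (Fin m)
  su_controlled : IsControlled K w (output (realMarkov (transferFn V sR)) su v) su
  /-- the input is stationary with an essentially bounded power spectral density -/
  u_stationary : IsStationary P u
  psd : ℝ → Matrix (Fin m) (Fin m) ℂ
  psd_spec : IsSpectralDensity (autocorr P u) psd
  psd_bounded : essSupNorm psd < ∞

namespace Experiment

variable {D : Set ℂ} {n p m : ℕ}

instance (E : Experiment.{u} D n p m) : MeasurableSpace E.Ω := E.mΩ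

instance (E : Experiment.{u} D n p m) : IsProbabilityMeasure E.P := E.isProb

/-- the output of the true system -/
def y (E : Experiment.{u} D n p m) : ℕ → E.Ω → EuclideanSpace ℝ (Fin p) :=
  output (realMarkov (transferFn (simpleBasis E.pole) E.R)) E.u E.v

/-- the output of the surrogate system -/
def sy (E : Experiment.{u} D n p m) : ℕ → E.Ω → EuclideanSpace ℝ (Fin p) :=
  output (realMarkov (transferFn E.V E.sR)) E.su E.v

/-- `ℙ₀`: the conditional law of `(y_1, …, y_N)` given `(u_0, …, u_{N-1})`, true system. -/
def law0 (E : Experiment.{u} D n p m) (N : ℕ) :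
    Kernel (Fin N → EuclideanSpace ℝ (Fin m)) (Fin N → EuclideanSpace ℝ (Fin p)) :=
  condDistrib (fun ω (t : Fin N) => E.y (t + 1) ω) (fun ω (t : Fin N) => E.u t ω) E.P

/-- `ℙ₁`: the conditional law of `(y_1, …, y_N)` given `(u_0, …, u_{N-1})`, surrogate system. -/
def law1 (E : Experiment.{u} D n p m) (N : ℕ) :
    Kernel (Fin N → EuclideanSpace ℝ (Fin m)) (Fin N → EuclideanSpace ℝ (Fin p)) :=
  condDistrib (fun ω (t : Fin N) => E.sy (t + 1) ω) (fun ω (t : Fin N) => E.su t ω) E.P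

/-- The expectation, over the input of the true system, of `D_KL(ℙ₀ ‖ ℙ₁)`. -/
def expectedKL (E : Experiment.{u} D n p m) (N : ℕ) : ℝ≥0∞ :=
  ∫⁻ ω, klDiv (E.law0 N fun t => E.u t ω) (E.law1 N fun t => E.u t ω) ∂E.P

/-- `R̄ = ∑ⱼ ‖Rⱼ‖` -/
def energy (E : Experiment.{u} D n p m) : ℝ := ∑ j, frobNorm (E.R j)

/-- `ρ_λ = maxⱼ |λⱼ|` -/
def rho (E : Experiment.{u} D n p m) : ℝ := ⨆ j, ‖E.pole j‖

/-- `‖𝓡⁻¹‖` -/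
def precNorm (E : Experiment.{u} D n p m) : ℝ := frobNorm E.cov⁻¹

/-- `ess sup_ω ‖Φ_u(ω)‖` -/
def psdSup (E : Experiment.{u} D n p m) : ℝ := (essSupNorm E.psd).toReal

end Experiment

end OBF

end

namespace OBF

/-! ### Hyperbolic Chebyshev constants -/

/-! The divergence is reduced to the `H₂` error of the surrogate, and that error to hyperbolic
distances between poles.

Probability. By the chain rule, the expected divergence of the conditional laws is at most the
divergence of the joint laws of inputs and outputs (`lintegral_klDiv_condDistrib_le`). The loop
operator plant ∘ controller is strictly causal, hence nilpotent, so closing the loop has Jacobian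
one: the joint law has density `g (y - T u)`, with `g` the noise density, against a measure that
does not depend on the plant `T` (`map_closedLoop_eq_withDensity`). The log-likelihood ratio is thus
a difference of quadratic forms in `v` and `v + e`, where `e` is the input filtered by the
difference of the plants. As `e` depends only on past noise, cross terms have mean zero, and half of
`‖𝓡⁻¹‖ ∑ E‖e_t‖²` bounds the divergence (`klDiv_joint_le`). In the frequency domain `E‖e_t‖²` is at
most `ess sup ‖Φ‖` times the energy of the difference of the impulse responses
(`integral_norm_sum_act_sq_le`), which Bessel's inequality bounds by the squared `H₂` error.

Approximation. Projecting `1 / (z - λ)` onto the orthonormal basis leaves a remainder whose modulus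
on the unit circle is exactly `∏ [λ, μₖ]_h / |z - λ|` (`exists_basis_approx`). The maximum principle
shows that poles optimal on the boundary of `D` make this product at most `τ_n ^ n` throughout `D`.
Superposing over the residues bounds the `H₂` error (`h2Norm_error_sq_le`) and gives the first two
claims.

Asymptotics. The quantities `τ_q ^ q` are submultiplicative, so Fekete's lemma yields the limit `τ`,
and the other factors disappear under the `2n`-th root. -/

lemma one_sub_conj_mul_ne_zero {z μ : ℂ} (hz : ‖z‖ ≤ 1) (hμ : ‖μ‖ < 1) :
    1 - (starRingEnd ℂ) μ * z ≠ 0 := by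
  intro h
  have h1 : ‖(starRingEnd ℂ) μ * z‖ = 1 := by rw [← sub_eq_zero.mp h, norm_one]
  rw [norm_mul, RCLike.norm_conj] at h1
  nlinarith [norm_nonneg μ, norm_nonneg z]

lemma pdist_nonneg (z μ : ℂ) : 0 ≤ pdist z μ := norm_nonneg _

/-- The difference of the squared moduli factors as `(1 - |z|²)(1 - |μ|²)`. -/
lemma norm_sub_le_norm_one_sub_conj_mul {z μ : ℂ} (hz : ‖z‖ ≤ 1) (hμ : ‖μ‖ ≤ 1) :
    ‖z - μ‖ ≤ ‖1 - (starRingEnd ℂ) μ * z‖ := by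
  rw [← abs_of_nonneg (norm_nonneg (z - μ)),
    ← abs_of_nonneg (norm_nonneg (1 - (starRingEnd ℂ) μ * z)), ← sq_le_sq]
  rw [← Complex.normSq_eq_norm_sq, ← Complex.normSq_eq_norm_sq]
  have h1 : Complex.normSq z ≤ 1 := by
    rw [Complex.normSq_eq_norm_sq]; exact pow_le_one₀ (norm_nonneg _) hz
  have h2 : Complex.normSq μ ≤ 1 := by
    rw [Complex.normSq_eq_norm_sq]; exact pow_le_one₀ (norm_nonneg _) hμ
  have h3 : Complex.normSq (1 - (starRingEnd ℂ) μ * z) - Complex.normSq (z - μ) =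
      (1 - Complex.normSq z) * (1 - Complex.normSq μ) := by
    simp [Complex.normSq_apply]
    ring
  nlinarith [mul_nonneg (sub_nonneg.2 h1) (sub_nonneg.2 h2)]

lemma pdist_le_one {z μ : ℂ} (hz : ‖z‖ ≤ 1) (hμ : ‖μ‖ ≤ 1) : pdist z μ ≤ 1 := by
  rw [pdist, norm_div]
  exact div_le_one_of_le₀ (norm_sub_le_norm_one_sub_conj_mul hz hμ) (norm_nonneg _)

/-- The `q`-th power of the finite hyperbolic Chebyshev constant, `min_μ max_z ∏ₖ [z, μₖ]_h`. -/
noncomputable def chebyshevProd (D : Set ℂ) (q : ℕ) : ℝ :=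
  ⨅ μ : Fin q → D, ⨆ z : D, ∏ k, pdist z (μ k)

section

variable {D : Set ℂ} (hD1 : D ⊆ Metric.ball (0 : ℂ) 1)

lemma prod_pdist_nonneg {q : ℕ} (μ : Fin q → ℂ) (z : ℂ) : 0 ≤ ∏ k, pdist z (μ k) :=
  Finset.prod_nonneg fun _ _ => pdist_nonneg _ _

lemma iSup_prod_pdist_nonneg {ι : Type*} {q : ℕ} (f : ι → ℂ) (μ : Fin q → ℂ) :
    0 ≤ ⨆ z, ∏ k, pdist (f z) (μ k) :=
  Real.iSup_nonneg fun _ => prod_pdist_nonneg _ _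

lemma chebyshevProd_nonneg (q : ℕ) : 0 ≤ chebyshevProd D q :=
  Real.iInf_nonneg fun μ => iSup_prod_pdist_nonneg _ fun k => (μ k : ℂ)

lemma chebyshevProd_le {q : ℕ} (μ : Fin q → D) :
    chebyshevProd D q ≤ ⨆ z : D, ∏ k, pdist z (μ k) := by
  refine ciInf_le ⟨0, ?_⟩ μ
  rintro _ ⟨ν, rfl⟩
  exact iSup_prod_pdist_nonneg _ fun k => (ν k : ℂ)

include hD1

lemma norm_lt_one_of_mem {z : ℂ} (hz : z ∈ D) : ‖z‖ < 1 := by simpa using hD1 hz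

lemma prod_pdist_le_one {q : ℕ} {μ : Fin q → ℂ} (hμ : ∀ k, μ k ∈ D) {z : ℂ} (hz : z ∈ D) :
    ∏ k, pdist z (μ k) ≤ 1 :=
  Finset.prod_le_one (fun _ _ => pdist_nonneg _ _) fun k _ =>
    pdist_le_one (norm_lt_one_of_mem hD1 hz).le (norm_lt_one_of_mem hD1 (hμ k)).le

lemma bddAbove_prod_pdist {ι : Type*} {q : ℕ} {μ : Fin q → ℂ} (hμ : ∀ k, μ k ∈ D) {f : ι → ℂ}
    (hf : ∀ i, f i ∈ D) : BddAbove (Set.range fun i => ∏ k, pdist (f i) (μ k)) := by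
  refine ⟨1, ?_⟩
  rintro _ ⟨i, rfl⟩
  exact prod_pdist_le_one hD1 hμ (hf i)

/-- The `q`-th root is continuous and monotone on `[0, ∞)`, so it commutes with the supremum and the
infimum. For `q = 0` the exponent is `0` and both sides are `1`. -/
lemma chebyshevFin_eq [Nonempty D] (q : ℕ) :
    chebyshevFin D q = chebyshevProd D q ^ (1 / (q : ℝ)) := by
  have hmono : MonotoneOn (fun x : ℝ => x ^ (1 / (q : ℝ))) (Set.Ici 0) :=
    Real.monotoneOn_rpow_Ici_of_exponent_nonneg (by positivity)
  have hcont : Continuous (fun x : ℝ => x ^ (1 / (q : ℝ))) :=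
    Real.continuous_rpow_const (by positivity)
  have hS : ∀ μ : Fin q → D, (⨆ z : D, (∏ k, pdist z (μ k)) ^ (1 / (q : ℝ))) =
      (⨆ z : D, ∏ k, pdist z (μ k)) ^ (1 / (q : ℝ)) := by
    intro μ
    refine Eq.trans ?_ (MonotoneOn.map_csSup_of_continuousWithinAt (A := Set.range fun z : D =>
      ∏ k, pdist z (μ k)) hcont.continuousWithinAt (hmono.mono ?_) (Set.range_nonempty _)
      (bddAbove_prod_pdist hD1 (fun k => (μ k).2) fun z => z.2)).symm
    · rw [← Set.range_comp]
      rfl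
    · rintro _ ⟨z, rfl⟩
      exact prod_pdist_nonneg _ _
  rw [chebyshevFin]
  simp_rw [hS]
  refine Eq.trans ?_ (MonotoneOn.map_csInf_of_continuousWithinAt (A := Set.range fun μ : Fin q → D =>
      ⨆ z : D, ∏ k, pdist z (μ k)) hcont.continuousWithinAt (hmono.mono ?_) (Set.range_nonempty _)
      ⟨0, ?_⟩).symm
  · rw [← Set.range_comp]
    rfl
  · rintro _ ⟨μ, rfl⟩
    exact iSup_prod_pdist_nonneg _ fun k => (μ k : ℂ)
  · rintro _ ⟨μ, rfl⟩
    exact iSup_prod_pdist_nonneg _ fun k => (μ k : ℂ)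

lemma chebyshevFin_pow [Nonempty D] {q : ℕ} (hq : q ≠ 0) :
    chebyshevFin D q ^ q = chebyshevProd D q := by
  rw [chebyshevFin_eq hD1, one_div, Real.rpow_inv_natCast_pow (chebyshevProd_nonneg q) hq]

/-- Concatenating two families of points multiplies their products, and a supremum of products is at
most the product of the suprema. This is the input to Fekete's lemma. -/
lemma chebyshevProd_add_le [Nonempty D] (p q : ℕ) :
    chebyshevProd D (p + q) ≤ chebyshevProd D p * chebyshevProd D q := by
  conv_rhs => rw [chebyshevProd, Real.iInf_mul_of_nonneg (chebyshevProd_nonneg q)]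
  refine le_ciInf fun μ => ?_
  rw [chebyshevProd, chebyshevProd,
    Real.mul_iInf_of_nonneg (iSup_prod_pdist_nonneg _ fun k => (μ k : ℂ))]
  refine le_ciInf fun ν => (chebyshevProd_le (Fin.append μ ν)).trans (ciSup_le fun z => ?_)
  rw [Fin.prod_univ_add]
  simp only [Fin.append_left, Fin.append_right]
  exact mul_le_mul
    (le_ciSup (bddAbove_prod_pdist hD1 (fun k => (μ k).2) fun z : D => z.2) z)
    (le_ciSup (bddAbove_prod_pdist hD1 (fun k => (ν k).2) fun z : D => z.2) z)
    (prod_pdist_nonneg _ _) (iSup_prod_pdist_nonneg _ fun k => (μ k : ℂ))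

/-- By submultiplicativity one zero forces zeros at all later indices. Positivity is what allows
logarithms to be taken. -/
lemma chebyshevProd_pos_of_frequently [Nonempty D] (h : ∃ᶠ q in atTop, 0 < chebyshevProd D q)
    (q : ℕ) : 0 < chebyshevProd D q := by
  refine (chebyshevProd_nonneg q).lt_of_ne' fun h0 => ?_
  obtain ⟨r, hr, hr'⟩ := (h.and_eventually (eventually_ge_atTop q)).exists
  have := chebyshevProd_add_le hD1 q (r - q)
  rw [h0, zero_mul, Nat.add_sub_cancel' hr'] at this
  exact this.not_gt hr

/-- The finite hyperbolic Chebyshev constants converge, by Fekete's lemma. -/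
lemma tendsto_chebyshevFin [Nonempty D] (hpos : ∀ q, 0 < chebyshevProd D q) :
    Tendsto (chebyshevFin D) atTop (𝓝 (chebyshev D)) := by
  have hsub : Subadditive fun q => Real.log (chebyshevProd D q) := fun p q => by
    rw [← Real.log_mul (hpos p).ne' (hpos q).ne']
    exact Real.log_le_log (hpos _) (chebyshevProd_add_le hD1 p q)
  have hexp : ∀ q, chebyshevFin D q = Real.exp (Real.log (chebyshevProd D q) / q) := fun q => by
    rw [chebyshevFin_eq hD1, Real.rpow_def_of_pos (hpos q), mul_one_div]
  have hbdd : BddBelow (Set.range fun q => chebyshevFin D (q + 1)) := by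
    refine ⟨0, ?_⟩
    rintro _ ⟨q, rfl⟩
    simp only [hexp]
    positivity
  -- The Fekete limit is the infimum over positive indices; the shift leaves out `q = 0`, where the
  -- root is a convention.
  refine tendsto_nhds_limUnder ⟨⨅ q, chebyshevFin D (q + 1), tendsto_order.2 ⟨?_, ?_⟩⟩
  · intro l hl
    filter_upwards [eventually_ge_atTop 1] with q hq
    obtain ⟨r, rfl⟩ := Nat.exists_eq_add_of_le' hq
    exact hl.trans_le (ciInf_le hbdd r)
  · intro u hu
    obtain ⟨q, hq⟩ := exists_lt_of_ciInf_lt hu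
    have hu0 : 0 < u := by
      rw [hexp] at hq
      exact (Real.exp_pos _).trans hq
    have := hsub.eventually_div_lt_of_div_lt (L := Real.log u) (n := q + 1) (by omega)
      (by rwa [Real.lt_log_iff_exp_lt hu0, ← hexp])
    filter_upwards [this] with r hr
    rwa [hexp, ← Real.lt_log_iff_exp_lt hu0]

/-- The maximum principle: a product of pseudohyperbolic distances is largest on the boundary. -/
lemma prod_pdist_le_minimaxObjective (hD : IsCompact D) {q : ℕ} {μ : Fin q → ℂ}
    (hμ : ∀ k, μ k ∈ D) {z : ℂ} (hz : z ∈ D) : ∏ k, pdist z (μ k) ≤ minimaxObjective D μ := by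
  have hfr : frontier D ⊆ D := hD.isClosed.frontier_subset
  have hb : ∀ w ∈ frontier D, ∏ k, pdist w (μ k) ≤ minimaxObjective D μ := fun w hw =>
    le_ciSup (bddAbove_prod_pdist hD1 hμ fun i : frontier D => hfr i.2) ⟨w, hw⟩
  by_cases h : z ∈ frontier D
  · exact hb z h
  have hz' : z ∈ interior D := by
    rw [hD.isClosed.frontier_eq] at h
    by_contra h'
    exact h ⟨hz, h'⟩
  have hprod : ∀ w, ‖∏ k, (w - μ k) / (1 - (starRingEnd ℂ) (μ k) * w)‖ = ∏ k, pdist w (μ k) :=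
    fun w => norm_prod _ _
  -- The product is analytic on the closure of the interior because that closure stays inside the
  -- open unit disk, away from the zeros of the denominators.
  have hcl : closure (interior D) ⊆ D := closure_minimal interior_subset hD.isClosed
  rw [← hprod]
  refine Complex.norm_le_of_forall_mem_frontier_norm_le (U := interior D)
    (f := fun w => ∏ k, (w - μ k) / (1 - (starRingEnd ℂ) (μ k) * w))
    (hD.isBounded.subset interior_subset) (DifferentiableOn.diffContOnCl fun w hw => ?_)
    (fun w hw => (hprod w).trans_le (hb w (frontier_interior_subset hw))) (subset_closure hz')
  refine DifferentiableAt.differentiableWithinAt ?_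
  refine DifferentiableAt.fun_finsetProd fun k _ => ?_
  refine DifferentiableAt.div (by fun_prop) (by fun_prop) ?_
  exact one_sub_conj_mul_ne_zero (norm_lt_one_of_mem hD1 (hcl hw)).le
    (norm_lt_one_of_mem hD1 (hμ k))

/-- Optimality concerns the boundary maximum only. The maximum principle carries it into `D`, while
a competitor's boundary maximum is at most its maximum over `D`. -/
lemma prod_pdist_le_chebyshevProd (hD : IsCompact D) {q : ℕ} {μ : Fin q → ℂ}
    (hμ : IsMinimaxPoles D μ) {z : ℂ} (hz : z ∈ D) :
    ∏ k, pdist z (μ k) ≤ chebyshevProd D q := by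
  have : Nonempty D := ⟨⟨z, hz⟩⟩
  have hfr : frontier D ⊆ D := hD.isClosed.frontier_subset
  refine le_ciInf fun ν => (prod_pdist_le_minimaxObjective hD1 hD hμ.1 hz).trans
    ((hμ.2 (fun k => ν k) fun k => (ν k).2).trans ?_)
  refine Real.iSup_le (fun w => ?_) (iSup_prod_pdist_nonneg _ fun k => (ν k : ℂ))
  exact le_ciSup (bddAbove_prod_pdist hD1 (fun k => (ν k).2) fun z : D => z.2) ⟨w, hfr w.2⟩

end

/-! ### Rational approximation on the unit circle -/

section Basis

variable {q : ℕ} {μ : Fin q → ℂ} {z : ℂ}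

lemma sub_ne_zero_of_norm {μ : ℂ} (hz : ‖z‖ = 1) (hμ : ‖μ‖ < 1) : z - μ ≠ 0 := by
  intro h
  rw [sub_eq_zero.mp h] at hz
  exact hμ.ne hz

lemma sqrt_one_sub_sq_mul_self {μ : ℂ} (hμ : ‖μ‖ < 1) :
    ((Real.sqrt (1 - ‖μ‖ ^ 2) : ℝ) : ℂ) * (Real.sqrt (1 - ‖μ‖ ^ 2) : ℝ) =
      1 - (starRingEnd ℂ) μ * μ := by
  rw [← Complex.ofReal_mul, Real.mul_self_sqrt (by nlinarith [norm_nonneg μ])]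
  push_cast
  rw [Complex.conj_mul']

lemma orthoBasis_castSucc (μ : Fin (q + 1) → ℂ) (k : Fin q) (z : ℂ) :
    orthoBasis μ k.castSucc z = orthoBasis (fun i => μ i.castSucc) k z := by
  simp only [orthoBasis, Finset.prod_filter, Fin.prod_univ_castSucc, Fin.castSucc_lt_castSucc_iff]
  rw [if_neg (not_lt.2 (Fin.le_last _)), mul_one]

lemma orthoBasis_last (μ : Fin (q + 1) → ℂ) (z : ℂ) :
    orthoBasis μ (Fin.last q) z =
      (Real.sqrt (1 - ‖μ (Fin.last q)‖ ^ 2) : ℂ) / (z - μ (Fin.last q)) *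
        ∏ l : Fin q, (1 - (starRingEnd ℂ) (μ l.castSucc) * z) / (z - μ l.castSucc) := by
  simp only [orthoBasis, Finset.prod_filter, Fin.prod_univ_castSucc, Fin.castSucc_lt_last,
    if_true, lt_irrefl, if_false, mul_one]

/-- The projection of `1 / (z - l)` onto the orthonormal basis functions leaves a Blaschke product
times `1 / (z - l)`. -/
lemma exists_orthoBasis_approx (hμ : ∀ k, ‖μ k‖ < 1) {l : ℂ} (hl : ‖l‖ < 1) :
    ∃ a : Fin q → ℂ, ∀ z : ℂ, ‖z‖ = 1 →
      1 / (z - l) - ∑ k, orthoBasis μ k z * a k =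
        (∏ k, (l - μ k) / (1 - (starRingEnd ℂ) (μ k) * l)) *
          (∏ k, (1 - (starRingEnd ℂ) (μ k) * z) / (z - μ k)) / (z - l) := by
  induction q with
  | zero => exact ⟨0, fun z _ => by simp⟩
  | succ q ih =>
    obtain ⟨a, ha⟩ := ih (μ := fun i => μ i.castSucc) fun k => hμ _
    -- The new coefficient is the inner product of `1 / (z - l)` with the last basis function,
    -- obtained from the residue at `l`.
    refine ⟨Fin.snoc a ((Real.sqrt (1 - ‖μ (Fin.last q)‖ ^ 2) : ℂ) /
      (1 - (starRingEnd ℂ) (μ (Fin.last q)) * l) *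
        ∏ k : Fin q, (l - μ k.castSucc) / (1 - (starRingEnd ℂ) (μ k.castSucc) * l)), fun z hz => ?_⟩
    have h := ha z hz
    simp only [Fin.sum_univ_castSucc, orthoBasis_castSucc, orthoBasis_last, Fin.snoc_castSucc,
      Fin.snoc_last, Fin.prod_univ_castSucc]
    rw [← sub_sub, h]
    set A := ∏ k : Fin q, (l - μ k.castSucc) / (1 - (starRingEnd ℂ) (μ k.castSucc) * l)
    set B := ∏ k : Fin q, (1 - (starRingEnd ℂ) (μ k.castSucc) * z) / (z - μ k.castSucc)
    set m := μ (Fin.last q)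
    have h1 : z - l ≠ 0 := sub_ne_zero_of_norm hz hl
    have h2 : z - m ≠ 0 := sub_ne_zero_of_norm hz (hμ _)
    have h3 : 1 - (starRingEnd ℂ) m * l ≠ 0 := one_sub_conj_mul_ne_zero hl.le (hμ _)
    have h4 : ((Real.sqrt (1 - ‖m‖ ^ 2) : ℝ) : ℂ) * (Real.sqrt (1 - ‖m‖ ^ 2) : ℝ) =
      1 - (starRingEnd ℂ) m * m := sqrt_one_sub_sq_mul_self (hμ (Fin.last q))
    set s := ((Real.sqrt (1 - ‖m‖ ^ 2) : ℝ) : ℂ)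
    have h5 : s / (z - m) * B * (s / (1 - (starRingEnd ℂ) m * l) * A) =
        (s * s) * (A * B) / ((z - m) * (1 - (starRingEnd ℂ) m * l)) := by
      field_simp
    rw [h5, h4]
    -- What remains is `(z - m)(1 - c l) - (1 - c m)(z - l) = (l - m)(1 - c z)`, a polynomial
    -- identity that holds with `c` independent of `m`.
    clear_value m
    generalize (starRingEnd ℂ) m = c at h3 ⊢
    have h6 : 1 - l * c ≠ 0 := by rwa [mul_comm]
    field_simp
    ring

/-- Partial fractions: a Blaschke product times `1 / (z - μ i)` is a combination of the simple
fractions `1 / (z - μ j)`. -/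
lemma exists_partialFractions (hμ : ∀ k, ‖μ k‖ < 1) (hinj : Function.Injective μ) (i : Fin q)
    (s : Finset (Fin q)) (hi : i ∉ s) :
    ∃ a : Fin q → ℂ, ∀ z : ℂ, ‖z‖ = 1 →
      1 / (z - μ i) * ∏ l ∈ s, (1 - (starRingEnd ℂ) (μ l) * z) / (z - μ l) =
        ∑ k ∈ insert i s, 1 / (z - μ k) * a k := by
  induction s using Finset.induction_on with
  | empty => exact ⟨1, fun z _ => by simp⟩
  | insert b s hb ih =>
    rw [Finset.mem_insert, not_or] at hi
    obtain ⟨a, ha⟩ := ih hi.2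
    have hbi : b ∉ insert i s := by simp [hb, Ne.symm hi.1]
    -- The new factor splits each old fraction in two: the residue at `μ k` is rescaled, and the
    -- residues at `μ b` coming from all old poles add up.
    refine ⟨fun k => if k = b then ∑ j ∈ insert i s,
        a j * (1 - (starRingEnd ℂ) (μ b) * μ b) / (μ b - μ j)
      else a k * (1 - (starRingEnd ℂ) (μ b) * μ k) / (μ k - μ b), fun z hz => ?_⟩
    rw [Finset.prod_insert hb, mul_left_comm, ha z hz, Finset.insert_comm, Finset.sum_insert hbi]
    dsimp only
    rw [if_pos rfl, Finset.mul_sum, Finset.mul_sum, ← Finset.sum_add_distrib]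
    refine Finset.sum_congr rfl fun k hk => ?_
    have hkb : k ≠ b := fun h => hbi (h ▸ hk)
    rw [if_neg hkb]
    have h1 : z - μ k ≠ 0 := sub_ne_zero_of_norm hz (hμ _)
    have h2 : z - μ b ≠ 0 := sub_ne_zero_of_norm hz (hμ _)
    have h3 : μ k - μ b ≠ 0 := sub_ne_zero.2 fun h => hkb (hinj h)
    have h4 : μ b - μ k ≠ 0 := sub_ne_zero.2 fun h => hkb (hinj h.symm)
    have h5 : a k * (1 - (starRingEnd ℂ) (μ b) * μ b) / (μ b - μ k) =
        -(a k * (1 - (starRingEnd ℂ) (μ b) * μ b) / (μ k - μ b)) := by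
      rw [← neg_sub (μ k), div_neg]
    rw [h5]
    field_simp
    ring

/-- With distinct poles, the approximant built from the orthonormal basis is therefore available in
the simple basis too. -/
lemma exists_simpleBasis_eq_orthoBasis (hμ : ∀ k, ‖μ k‖ < 1) (hinj : Function.Injective μ)
    (i : Fin q) : ∃ a : Fin q → ℂ, ∀ z : ℂ, ‖z‖ = 1 →
      orthoBasis μ i z = ∑ k, simpleBasis μ k z * a k := by
  obtain ⟨a, ha⟩ := exists_partialFractions hμ hinj i
    (Finset.univ.filter fun l => l < i) (by simp)
  refine ⟨fun k => if k ∈ insert i (Finset.univ.filter fun l => l < i) then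
    (Real.sqrt (1 - ‖μ i‖ ^ 2) : ℂ) * a k else 0, fun z hz => ?_⟩
  rw [orthoBasis, div_eq_mul_one_div, mul_assoc, ha z hz, Finset.mul_sum]
  simp only [mul_ite, mul_zero, simpleBasis]
  rw [Finset.sum_ite_mem, Finset.univ_inter]
  exact Finset.sum_congr rfl fun k _ => by ring

/-- On the circle `1 - conj μ * z = z * conj (z - μ)`, so the factors depending on `z` are
unimodular and only the Blaschke product at `l` survives. -/
lemma exists_basis_approx {V : Fin q → ℂ → ℂ} (hV : IsBasisFor μ V) (hμ : ∀ k, ‖μ k‖ < 1) {l : ℂ}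
    (hl : ‖l‖ < 1) :
    ∃ a : Fin q → ℂ, ∀ z : ℂ, ‖z‖ = 1 →
      ‖1 / (z - l) - ∑ k, V k z * a k‖ = (∏ k, pdist l (μ k)) * ‖z - l‖⁻¹ := by
  obtain ⟨a, ha⟩ := exists_orthoBasis_approx hμ hl
  have hnorm : ∀ z : ℂ, ‖z‖ = 1 → ‖1 / (z - l) - ∑ k, orthoBasis μ k z * a k‖ =
      (∏ k, pdist l (μ k)) * ‖z - l‖⁻¹ := by
    intro z hz
    rw [ha z hz, norm_div, norm_mul, norm_prod, norm_prod, div_eq_mul_inv]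
    have : ∀ k, ‖(1 - (starRingEnd ℂ) (μ k) * z) / (z - μ k)‖ = 1 := by
      intro k
      rw [norm_div, div_eq_one_iff_eq (norm_ne_zero_iff.2 (sub_ne_zero_of_norm hz (hμ k)))]
      have h1 : z * (starRingEnd ℂ) (z - μ k) = 1 - (starRingEnd ℂ) (μ k) * z := by
        rw [map_sub, mul_sub, Complex.mul_conj', hz]
        push_cast
        ring
      rw [← h1, norm_mul, hz, one_mul, RCLike.norm_conj]
    simp only [this, Finset.prod_const_one, mul_one]
    rfl
  rcases hV with ⟨hinj, rfl⟩ | rfl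
  · choose c hc using exists_simpleBasis_eq_orthoBasis hμ hinj
    refine ⟨fun i => ∑ k, c k i * a k, fun z hz => ?_⟩
    rw [← hnorm z hz]
    congr 2
    simp only [hc _ z hz, Finset.mul_sum, Finset.sum_mul]
    rw [Finset.sum_comm]
    exact Finset.sum_congr rfl fun i _ => Finset.sum_congr rfl fun k _ => by ring
  · exact ⟨a, hnorm⟩

lemma norm_cexp_ofReal_mul_I (ω : ℝ) : ‖Complex.exp (ω * Complex.I)‖ = 1 :=
  Complex.norm_exp_ofReal_mul_I ω

lemma continuous_simpleBasis (hμ : ∀ k, ‖μ k‖ < 1) (k : Fin q) :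
    Continuous fun ω : ℝ => simpleBasis μ k (Complex.exp (ω * Complex.I)) := by
  unfold simpleBasis
  exact Continuous.div (by fun_prop) (by fun_prop)
    fun ω => sub_ne_zero_of_norm (norm_cexp_ofReal_mul_I ω) (hμ k)

lemma continuous_basis {V : Fin q → ℂ → ℂ} (hV : IsBasisFor μ V) (hμ : ∀ k, ‖μ k‖ < 1)
    (k : Fin q) : Continuous fun ω : ℝ => V k (Complex.exp (ω * Complex.I)) := by
  rcases hV with ⟨-, rfl⟩ | rfl
  · exact continuous_simpleBasis hμ k
  · unfold orthoBasis
    refine Continuous.mul (Continuous.div (by fun_prop) (by fun_prop)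
      fun ω => sub_ne_zero_of_norm (norm_cexp_ofReal_mul_I ω) (hμ k)) ?_
    exact continuous_finsetProd _ fun l _ => Continuous.div (by fun_prop) (by fun_prop)
      fun ω => sub_ne_zero_of_norm (norm_cexp_ofReal_mul_I ω) (hμ l)

lemma continuous_transferFn {p m : ℕ} {V : Fin q → ℂ → ℂ}
    (hV : ∀ k, Continuous fun ω : ℝ => V k (Complex.exp (ω * Complex.I)))
    (R : Fin q → Matrix (Fin p) (Fin m) ℂ) :
    Continuous fun ω : ℝ => transferFn V R (Complex.exp (ω * Complex.I)) := by
  unfold transferFn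
  exact continuous_finsetSum _ fun k _ => (hV k).smul continuous_const

end Basis

/-! ### The Frobenius norm -/

section Frobenius

variable {𝕜 : Type*} [RCLike 𝕜] {p m : ℕ}

lemma frobNorm_nonneg (A : Matrix (Fin p) (Fin m) 𝕜) : 0 ≤ frobNorm A := Real.sqrt_nonneg _

lemma frobNorm_sq (A : Matrix (Fin p) (Fin m) 𝕜) : frobNorm A ^ 2 = ∑ i, ∑ j, ‖A i j‖ ^ 2 :=
  Real.sq_sqrt (by positivity)

lemma frobNorm_eq_norm (A : Matrix (Fin p) (Fin m) 𝕜) :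
    frobNorm A = ‖(WithLp.toLp 2 fun ij : Fin p × Fin m => A ij.1 ij.2 :
      EuclideanSpace 𝕜 (Fin p × Fin m))‖ := by
  rw [EuclideanSpace.norm_eq, frobNorm, Fintype.sum_prod_type]

lemma frobNorm_sum_smul_le {ι : Type*} (s : Finset ι) (a : ι → 𝕜)
    (R : ι → Matrix (Fin p) (Fin m) 𝕜) :
    frobNorm (∑ j ∈ s, a j • R j) ≤ ∑ j ∈ s, frobNorm (R j) * ‖a j‖ := by
  simp only [frobNorm_eq_norm]
  have : (WithLp.toLp 2 fun ij : Fin p × Fin m => (∑ j ∈ s, a j • R j) ij.1 ij.2 :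
      EuclideanSpace 𝕜 (Fin p × Fin m)) = ∑ j ∈ s, a j •
        (WithLp.toLp 2 fun ij : Fin p × Fin m => R j ij.1 ij.2) := by
    ext ij
    simp [Matrix.sum_apply]
  rw [this]
  refine (norm_sum_le _ _).trans (Finset.sum_le_sum fun j _ => ?_)
  rw [norm_smul, mul_comm]

lemma continuous_frobNorm : Continuous (frobNorm : Matrix (Fin p) (Fin m) 𝕜 → ℝ) := by
  unfold frobNorm
  fun_prop

end Frobenius

/-! ### Fourier coefficients over a period -/

lemma integral_cexp_int_mul (k : ℤ) :
    ∫ ω in (-Real.pi)..Real.pi, Complex.exp (k * ω * Complex.I) =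
      if k = 0 then ((2 * Real.pi : ℝ) : ℂ) else 0 := by
  split_ifs with hk
  · simp only [hk, Int.cast_zero, zero_mul, Complex.exp_zero, intervalIntegral.integral_const,
      Complex.real_smul, mul_one]
    congr 1
    ring
  · have hc : (k : ℂ) * Complex.I ≠ 0 := mul_ne_zero (by exact_mod_cast hk) Complex.I_ne_zero
    have : (fun ω : ℝ => Complex.exp (k * ω * Complex.I)) =
        fun ω : ℝ => Complex.exp (k * Complex.I * ω) := by
      ext ω; ring_nf
    rw [this, integral_exp_mul_complex hc, div_eq_zero_iff]
    left
    rw [sub_eq_zero, Complex.exp_eq_exp_iff_exists_int]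
    exact ⟨k, by push_cast; ring⟩

lemma two_pi_inv_mul_self : ((2 * Real.pi : ℝ) : ℂ)⁻¹ * ((2 * Real.pi : ℝ) : ℂ) = 1 :=
  inv_mul_cancel₀ (by exact_mod_cast Real.two_pi_pos.ne')

lemma norm_sq_ofReal (z : ℂ) : ((‖z‖ ^ 2 : ℝ) : ℂ) = z * (starRingEnd ℂ) z := by
  rw [Complex.mul_conj']
  push_cast
  rfl

lemma conj_cexp (x : ℝ) :
    (starRingEnd ℂ) (Complex.exp (-(x * Complex.I))) = Complex.exp (x * Complex.I) := by
  rw [← Complex.exp_conj]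
  simp

lemma conj_cexp_mul (l : ℕ) (ω : ℝ) :
    (starRingEnd ℂ) (Complex.exp (-(l * ω * Complex.I))) = Complex.exp (l * ω * Complex.I) := by
  have := conj_cexp (l * ω)
  push_cast at this
  exact this

/-- Parseval's identity for trigonometric polynomials. -/
lemma mean_norm_sq_trigPoly (s : Finset ℕ) (c : ℕ → ℂ) :
    (2 * Real.pi)⁻¹ * ∫ ω in (-Real.pi)..Real.pi,
      ‖∑ l ∈ s, c l * Complex.exp (-(l * ω * Complex.I))‖ ^ 2 = ∑ l ∈ s, ‖c l‖ ^ 2 := by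
  have hC : ((2 * Real.pi : ℝ) : ℂ)⁻¹ * ∫ ω in (-Real.pi)..Real.pi,
      ((‖∑ l ∈ s, c l * Complex.exp (-(l * ω * Complex.I))‖ ^ 2 : ℝ) : ℂ) =
      ((∑ l ∈ s, ‖c l‖ ^ 2 : ℝ) : ℂ) := by
    have h1 : ∀ ω : ℝ, ((‖∑ l ∈ s, c l * Complex.exp (-(l * ω * Complex.I))‖ ^ 2 : ℝ) : ℂ) =
        ∑ l ∈ s, ∑ k ∈ s, c l * (starRingEnd ℂ) (c k) *
          Complex.exp ((((k : ℤ) - (l : ℤ) : ℤ) : ℂ) * ω * Complex.I) := by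
      intro ω
      rw [norm_sq_ofReal, map_sum, Finset.sum_mul_sum]
      refine Finset.sum_congr rfl fun l _ => Finset.sum_congr rfl fun k _ => ?_
      rw [map_mul, conj_cexp_mul, mul_mul_mul_comm, ← Complex.exp_add]
      congr 2
      push_cast
      ring
    simp_rw [h1]
    rw [intervalIntegral.integral_finsetSum fun l _ =>
      Continuous.intervalIntegrable (by fun_prop) _ _, Finset.mul_sum, Complex.ofReal_sum]
    refine Finset.sum_congr rfl fun l hl => ?_
    rw [intervalIntegral.integral_finsetSum fun k _ =>
      Continuous.intervalIntegrable (by fun_prop) _ _]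
    simp only [intervalIntegral.integral_const_mul, integral_cexp_int_mul, sub_eq_zero,
      Nat.cast_inj, mul_ite, mul_zero]
    rw [Finset.sum_ite_eq' s l, if_pos hl, mul_left_comm, two_pi_inv_mul_self, mul_one,
      norm_sq_ofReal]
  rw [intervalIntegral.integral_ofReal] at hC
  exact_mod_cast hC

/-- Bessel's inequality. -/
lemma sum_norm_sq_fourierCoeff_le {f : ℝ → ℂ} (hf : Continuous f) (s : Finset ℕ) :
    ∑ l ∈ s, ‖((2 * Real.pi : ℝ) : ℂ)⁻¹ *
      ∫ ω in (-Real.pi)..Real.pi, f ω * Complex.exp (l * ω * Complex.I)‖ ^ 2 ≤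
    (2 * Real.pi)⁻¹ * ∫ ω in (-Real.pi)..Real.pi, ‖f ω‖ ^ 2 := by
  set c : ℕ → ℂ := fun l => ((2 * Real.pi : ℝ) : ℂ)⁻¹ *
      ∫ ω in (-Real.pi)..Real.pi, f ω * Complex.exp (l * ω * Complex.I) with hc
  -- `p` is the orthogonal projection of `f`; the inequality is the nonnegativity of the mean of `‖f
  -- - p‖ ^ 2`, whose cross term is twice the energy of `p`.
  set p : ℝ → ℂ := fun ω => ∑ l ∈ s, c l * Complex.exp (-(l * ω * Complex.I)) with hp
  have hpc : Continuous p := by fun_prop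
  have hcross : (2 * Real.pi)⁻¹ * ∫ ω in (-Real.pi)..Real.pi, (f ω * (starRingEnd ℂ) (p ω)).re =
      ∑ l ∈ s, ‖c l‖ ^ 2 := by
    have h1 : ((2 * Real.pi : ℝ) : ℂ)⁻¹ *
        ∫ ω in (-Real.pi)..Real.pi, f ω * (starRingEnd ℂ) (p ω) =
        ((∑ l ∈ s, ‖c l‖ ^ 2 : ℝ) : ℂ) := by
      have h2 : ∀ ω, f ω * (starRingEnd ℂ) (p ω) = ∑ l ∈ s, (starRingEnd ℂ) (c l) *
          (f ω * Complex.exp (l * ω * Complex.I)) := by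
        intro ω
        rw [hp, map_sum, Finset.mul_sum]
        refine Finset.sum_congr rfl fun l _ => ?_
        rw [map_mul, conj_cexp_mul]
        ring
      simp_rw [h2]
      rw [intervalIntegral.integral_finsetSum fun l _ =>
        Continuous.intervalIntegrable (by fun_prop) _ _, Finset.mul_sum, Complex.ofReal_sum]
      refine Finset.sum_congr rfl fun l _ => ?_
      rw [intervalIntegral.integral_const_mul, mul_left_comm, norm_sq_ofReal, mul_comm]
    have h3 := congrArg Complex.re h1
    rw [Complex.ofReal_re, ← Complex.ofReal_inv, Complex.re_ofReal_mul] at h3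
    rw [← h3]
    congr 1
    exact Complex.reCLM.intervalIntegral_comp_comm (f := fun ω => f ω * (starRingEnd ℂ) (p ω))
      (Continuous.intervalIntegrable (by fun_prop) _ _)
  have hpars := mean_norm_sq_trigPoly s c
  have hpos : 0 ≤ (2 * Real.pi)⁻¹ * ∫ ω in (-Real.pi)..Real.pi, ‖f ω - p ω‖ ^ 2 :=
    mul_nonneg (by positivity) (intervalIntegral.integral_nonneg (by linarith [Real.pi_pos])
      fun _ _ => by positivity)
  have hexp : ∀ ω, ‖f ω - p ω‖ ^ 2 = ‖f ω‖ ^ 2 - 2 * (f ω * (starRingEnd ℂ) (p ω)).re +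
      ‖p ω‖ ^ 2 := by
    intro ω
    rw [← Complex.normSq_eq_norm_sq, ← Complex.normSq_eq_norm_sq, ← Complex.normSq_eq_norm_sq,
      Complex.normSq_sub]
    ring
  simp_rw [hexp] at hpos
  rw [intervalIntegral.integral_add (Continuous.intervalIntegrable (by fun_prop) _ _)
    (Continuous.intervalIntegrable (by fun_prop) _ _),
    intervalIntegral.integral_sub (Continuous.intervalIntegrable (by fun_prop) _ _)
    (Continuous.intervalIntegrable (by fun_prop) _ _), intervalIntegral.integral_const_mul,
    mul_add, mul_sub, mul_left_comm, hcross, hpars] at hpos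
  linarith

/-- On the circle `|z - l|² = (z - l)(1 - conj l * z) / z`, so the mean is a Cauchy integral
evaluating `(1 - conj l * z)⁻¹` at `l`. -/
lemma mean_inv_norm_sub_sq {l : ℂ} (hl : ‖l‖ < 1) :
    (2 * Real.pi)⁻¹ * ∫ ω in (-Real.pi)..Real.pi, (‖Complex.exp (ω * Complex.I) - l‖⁻¹) ^ 2 =
      (1 - ‖l‖ ^ 2)⁻¹ := by
  have hne : ∀ z : ℂ, ‖z‖ ≤ 1 → 1 - (starRingEnd ℂ) l * z ≠ 0 := fun z hz =>
    one_sub_conj_mul_ne_zero hz hl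
  have hcauchy : (∮ z in C(0, 1), (z - l)⁻¹ • (1 - (starRingEnd ℂ) l * z)⁻¹) =
      (2 * Real.pi * Complex.I : ℂ) • (1 - (starRingEnd ℂ) l * l)⁻¹ := by
    refine DiffContOnCl.circleIntegral_sub_inv_smul (c := 0) (w := l) (R := 1)
      (f := fun z => (1 - (starRingEnd ℂ) l * z)⁻¹)
      (DifferentiableOn.diffContOnCl fun z hz => ?_) (by simpa using hl)
    have hz' : ‖z‖ ≤ 1 := by simpa using Metric.closure_ball_subset_closedBall hz
    have hd : DifferentiableAt ℂ (fun z => 1 - (starRingEnd ℂ) l * z) z := by fun_prop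
    exact (hd.inv (hne z hz')).differentiableWithinAt
  have hper : Function.Periodic (fun ω : ℝ => (‖Complex.exp (ω * Complex.I) - l‖⁻¹) ^ 2)
      (2 * Real.pi) := by
    intro ω
    simp only
    congr 4
    rw [Complex.exp_eq_exp_iff_exists_int]
    exact ⟨1, by push_cast; ring⟩
  have hshift := hper.intervalIntegral_add_eq (-Real.pi) 0
  rw [show -Real.pi + 2 * Real.pi = Real.pi by ring, zero_add] at hshift
  rw [hshift]
  have hC : (∮ z in C(0, 1), (z - l)⁻¹ • (1 - (starRingEnd ℂ) l * z)⁻¹) =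
      Complex.I * ∫ ω in (0 : ℝ)..2 * Real.pi,
        (((‖Complex.exp (ω * Complex.I) - l‖⁻¹) ^ 2 : ℝ) : ℂ) := by
    rw [circleIntegral, ← intervalIntegral.integral_const_mul]
    refine intervalIntegral.integral_congr fun ω _ => ?_
    simp only [deriv_circleMap, circleMap, Complex.ofReal_one, one_mul, zero_add, smul_eq_mul]
    set z := Complex.exp (ω * Complex.I)
    have hz : ‖z‖ = 1 := norm_cexp_ofReal_mul_I ω
    have h1 : 1 - (starRingEnd ℂ) l * z = z * (starRingEnd ℂ) (z - l) := by
      rw [map_sub, mul_sub, Complex.mul_conj', hz]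
      push_cast
      ring
    have h2 : z ≠ 0 := by rw [← norm_ne_zero_iff, hz]; exact one_ne_zero
    rw [inv_pow, Complex.ofReal_inv, norm_sq_ofReal, h1, mul_inv, mul_inv]
    field_simp
  rw [hcauchy, intervalIntegral.integral_ofReal, smul_eq_mul] at hC
  have h1 : ((∫ ω in (0 : ℝ)..2 * Real.pi, (‖Complex.exp (ω * Complex.I) - l‖⁻¹) ^ 2 : ℝ) : ℂ) =
      ((2 * Real.pi * (1 - ‖l‖ ^ 2)⁻¹ : ℝ) : ℂ) := by
    have h2 := Complex.conj_mul' l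
    rw [h2] at hC
    push_cast at hC ⊢
    refine mul_left_cancel₀ Complex.I_ne_zero (hC.symm.trans ?_)
    ring
  rw [Complex.ofReal_inj.mp h1, ← mul_assoc, inv_mul_cancel₀ Real.two_pi_pos.ne', one_mul]

/-! ### The `H₂` norm of the approximation error -/

section Error

variable {p m n : ℕ}

lemma h2Norm_sq (F : ℂ → Matrix (Fin p) (Fin m) ℂ) :
    h2Norm F ^ 2 = (2 * Real.pi)⁻¹ *
      ∫ ω in (-Real.pi)..Real.pi, frobNorm (F (Complex.exp (ω * Complex.I))) ^ 2 :=
  Real.sq_sqrt (mul_nonneg (by positivity)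
    (intervalIntegral.integral_nonneg (by linarith [Real.pi_pos]) fun _ _ => by positivity))

lemma h2Norm_nonneg (F : ℂ → Matrix (Fin p) (Fin m) ℂ) : 0 ≤ h2Norm F := Real.sqrt_nonneg _

/-- The optimal coefficients do at least as well as `S`, which superposes the single-pole
approximants. Their errors are known pointwise, and `1 / |z - λ|²` has mean `1 / (1 - |λ|²)`. -/
lemma h2Norm_error_sq_le {pole μ : Fin n → ℂ} (hpole : ∀ j, ‖pole j‖ < 1) (hμ : ∀ k, ‖μ k‖ < 1)
    {V : Fin n → ℂ → ℂ} (hV : IsBasisFor μ V) (R : Fin n → Matrix (Fin p) (Fin m) ℂ)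
    {R' : Fin n → Matrix (Fin p) (Fin m) ℂ}
    (hopt : IsH2Optimal (transferFn (simpleBasis pole) R) V R') {C ρ : ℝ}
    (hC : ∀ j, ∏ k, pdist (pole j) (μ k) ≤ C) (hρ : ∀ j, ‖pole j‖ ≤ ρ) (hρ1 : ρ < 1) :
    h2Norm (fun z => transferFn (simpleBasis pole) R z - transferFn V R' z) ^ 2 ≤
      (∑ j, frobNorm (R j)) ^ 2 * (C ^ 2 * (1 - ρ ^ 2)⁻¹) := by
  choose a ha using fun j => exists_basis_approx hV hμ (hpole j)
  set S : Fin n → Matrix (Fin p) (Fin m) ℂ := fun k => ∑ j, a j k • R j with hS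
  refine (pow_le_pow_left₀ (h2Norm_nonneg _) (hopt S) 2).trans ?_
  have hdiff : ∀ z, transferFn (simpleBasis pole) R z - transferFn V S z =
      ∑ j, (1 / (z - pole j) - ∑ k, V k z * a j k) • R j := by
    intro z
    simp only [transferFn, simpleBasis, hS, Finset.smul_sum, sub_smul, Finset.sum_smul,
      Finset.sum_sub_distrib, smul_smul]
    rw [Finset.sum_comm]
  have hpt : ∀ ω : ℝ, frobNorm (transferFn (simpleBasis pole) R (Complex.exp (ω * Complex.I)) -
      transferFn V S (Complex.exp (ω * Complex.I))) ^ 2 ≤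
      (∑ j, frobNorm (R j)) * ∑ j, frobNorm (R j) * (C ^ 2 *
        (‖Complex.exp (ω * Complex.I) - pole j‖⁻¹) ^ 2) := by
    intro ω
    set z := Complex.exp (ω * Complex.I) with hz
    have hz1 : ‖z‖ = 1 := norm_cexp_ofReal_mul_I ω
    rw [hdiff]
    refine (pow_le_pow_left₀ (frobNorm_nonneg _) ((frobNorm_sum_smul_le _ _ _).trans
      (Finset.sum_le_sum (g := fun j => frobNorm (R j) * (C * ‖z - pole j‖⁻¹))
        fun j _ => ?_)) 2).trans ?_
    · rw [ha j z hz1]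
      exact mul_le_mul_of_nonneg_left (mul_le_mul_of_nonneg_right (hC j) (by positivity))
        (frobNorm_nonneg _)
    -- Cauchy–Schwarz with weights `‖Rⱼ‖` produces `R̄²` with no additional factor `n`.
    · refine Finset.sum_sq_le_sum_mul_sum_of_sq_le_mul _ (fun j _ => frobNorm_nonneg _)
        (fun j _ => mul_nonneg (frobNorm_nonneg _) (by positivity)) fun j _ => le_of_eq (by ring)
  have hcont : ∀ j, Continuous fun ω : ℝ => (‖Complex.exp (ω * Complex.I) - pole j‖⁻¹) ^ 2 :=
    fun j => ((Continuous.norm (by fun_prop)).inv₀ fun ω => norm_ne_zero_iff.2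
      (sub_ne_zero_of_norm (norm_cexp_ofReal_mul_I ω) (hpole j))).pow 2
  have hint' : ∀ j, IntervalIntegrable (fun ω : ℝ => frobNorm (R j) * (C ^ 2 *
      (‖Complex.exp (ω * Complex.I) - pole j‖⁻¹) ^ 2)) volume (-Real.pi) Real.pi := fun j =>
    (continuous_const.mul (continuous_const.mul (hcont j))).intervalIntegrable _ _
  have hcont2 : Continuous fun ω : ℝ => (∑ j, frobNorm (R j)) * ∑ j, frobNorm (R j) * (C ^ 2 *
        (‖Complex.exp (ω * Complex.I) - pole j‖⁻¹) ^ 2) :=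
    continuous_const.mul (continuous_finsetSum _ fun j _ =>
      continuous_const.mul (continuous_const.mul (hcont j)))
  rw [h2Norm_sq]
  have hint := intervalIntegral.integral_mono (μ := volume) (a := -Real.pi) (b := Real.pi)
    (by linarith [Real.pi_pos])
    (Continuous.intervalIntegrable ((continuous_frobNorm.comp ((continuous_transferFn
      (continuous_simpleBasis hpole) R).sub (continuous_transferFn (continuous_basis hV hμ) S))).pow
        2) _ _) (hcont2.intervalIntegrable _ _) hpt
  refine (mul_le_mul_of_nonneg_left hint (by positivity)).trans ?_
  rw [intervalIntegral.integral_const_mul, intervalIntegral.integral_finsetSum fun j _ => hint' j]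
  simp only [intervalIntegral.integral_const_mul]
  rw [mul_left_comm, Finset.mul_sum, pow_two (∑ j, frobNorm (R j)), mul_assoc]
  refine mul_le_mul_of_nonneg_left ?_ (Finset.sum_nonneg fun j _ => frobNorm_nonneg _)
  rw [Finset.sum_mul]
  refine Finset.sum_le_sum fun j _ => ?_
  rw [mul_left_comm]
  refine mul_le_mul_of_nonneg_left ?_ (frobNorm_nonneg _)
  rw [mul_left_comm, mean_inv_norm_sub_sq (hpole j)]
  refine mul_le_mul_of_nonneg_left ?_ (by positivity)
  have h0 : 0 ≤ ρ := (norm_nonneg _).trans (hρ j)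
  exact inv_anti₀ (by nlinarith) (by nlinarith [hρ j, norm_nonneg (pole j)])

/-- Bessel's inequality is applied entry by entry; taking real parts only decreases moduli, so
neither system has to be real. -/
lemma sum_frobNorm_realMarkov_sub_sq_le {F F' : ℂ → Matrix (Fin p) (Fin m) ℂ}
    (hF : Continuous fun ω : ℝ => F (Complex.exp (ω * Complex.I)))
    (hF' : Continuous fun ω : ℝ => F' (Complex.exp (ω * Complex.I))) (s : Finset ℕ) :
    ∑ l ∈ s, frobNorm (realMarkov F l - realMarkov F' l) ^ 2 ≤
      h2Norm (fun z => F z - F' z) ^ 2 := by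
  have hc : ∀ i j, Continuous fun ω : ℝ => F (Complex.exp (ω * Complex.I)) i j :=
    fun i j => hF.matrix_elem i j
  have hc' : ∀ i j, Continuous fun ω : ℝ => F' (Complex.exp (ω * Complex.I)) i j :=
    fun i j => hF'.matrix_elem i j
  have hle : ∀ l i j, ‖realMarkov F l i j - realMarkov F' l i j‖ ^ 2 ≤
      ‖((2 * Real.pi : ℝ) : ℂ)⁻¹ * ∫ ω in (-Real.pi)..Real.pi,
        (F (Complex.exp (ω * Complex.I)) i j - F' (Complex.exp (ω * Complex.I)) i j) *
          Complex.exp (l * ω * Complex.I)‖ ^ 2 := by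
    intro l i j
    have h1 : realMarkov F l i j - realMarkov F' l i j =
        (((2 * Real.pi : ℝ) : ℂ)⁻¹ * ∫ ω in (-Real.pi)..Real.pi,
        (F (Complex.exp (ω * Complex.I)) i j - F' (Complex.exp (ω * Complex.I)) i j) *
          Complex.exp (l * ω * Complex.I)).re := by
      have hi : ∀ f : ℝ → ℂ, Continuous f → IntervalIntegrable
          (fun ω : ℝ => f ω * Complex.exp (l * ω * Complex.I)) volume (-Real.pi) Real.pi :=
        fun f hf => Continuous.intervalIntegrable (by fun_prop) _ _
      simp only [sub_mul]
      rw [intervalIntegral.integral_sub (hi _ (hc i j)) (hi _ (hc' i j)), mul_sub, Complex.sub_re]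
      rfl
    rw [h1]
    exact pow_le_pow_left₀ (norm_nonneg _) (Complex.abs_re_le_norm _) 2
  have hi : ∀ i j, Continuous fun ω : ℝ => ‖F (Complex.exp (ω * Complex.I)) i j -
      F' (Complex.exp (ω * Complex.I)) i j‖ ^ 2 := fun i j =>
    ((hc i j).sub (hc' i j)).norm.pow 2
  simp only [h2Norm_sq, frobNorm_sq, Matrix.sub_apply]
  rw [intervalIntegral.integral_finsetSum fun i _ => Continuous.intervalIntegrable
    (continuous_finsetSum _ fun j _ => hi i j) _ _, Finset.mul_sum, Finset.sum_comm]
  refine Finset.sum_le_sum fun i _ => ?_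
  rw [intervalIntegral.integral_finsetSum fun j _ => Continuous.intervalIntegrable
    (hi i j) _ _, Finset.mul_sum, Finset.sum_comm]
  refine Finset.sum_le_sum fun j _ => ?_
  exact (Finset.sum_le_sum fun l _ => hle l i j).trans
    (sum_norm_sq_fourierCoeff_le ((hc i j).sub (hc' i j)) s)

end Error

/-! ### Conditional Kullback–Leibler divergence -/

section CondKL

variable {α β : Type*} {mα : MeasurableSpace α} {mβ : MeasurableSpace β}

/-- A measurable majorant suffices for a change of variables in the integral, so the measurability
of the divergence in `x` need not be settled. The majorant uses the jointly measurable kernel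
derivative; without absolute continuity the right side is infinite. -/
lemma exists_measurable_ge_klDiv [MeasurableSpace.CountablyGenerated β] (μ : Measure α)
    [IsFiniteMeasure μ] (κ η : Kernel α β) [IsMarkovKernel κ] [IsMarkovKernel η] :
    ∃ h : α → ℝ≥0∞, Measurable h ∧ (∀ᵐ x ∂μ, klDiv (κ x) (η x) ≤ h x) ∧
      ∫⁻ x, h x ∂μ ≤ klDiv (μ ⊗ₘ κ) (μ ⊗ₘ η) := by
  by_cases hac : μ ⊗ₘ κ ≪ μ ⊗ₘ η
  swap
  · exact ⟨fun _ => ∞, measurable_const, by simp, by simp [klDiv_of_not_ac hac]⟩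
  have hae : ∀ᵐ x ∂μ, κ x ≪ η x := hac.kernel_of_compProd
  have hmeas : Measurable fun p : α × β => Kernel.rnDeriv κ η p.1 p.2 :=
    Kernel.measurable_rnDeriv κ η
  have hwd : μ ⊗ₘ κ = (μ ⊗ₘ η).withDensity fun p => Kernel.rnDeriv κ η p.1 p.2 := by
    rw [← Measure.compProd_withDensity hmeas]
    refine Measure.compProd_congr ?_
    filter_upwards [hae] with x hx
    exact (Kernel.withDensity_rnDeriv_eq hx).symm
  have hrn : (μ ⊗ₘ κ).rnDeriv (μ ⊗ₘ η) =ᵐ[μ ⊗ₘ η] fun p => Kernel.rnDeriv κ η p.1 p.2 := by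
    conv_lhs => rw [hwd]
    exact Measure.rnDeriv_withDensity _ hmeas
  have hmk : Measurable fun p : α × β =>
      ENNReal.ofReal (klFun (Kernel.rnDeriv κ η p.1 p.2).toReal) := by fun_prop
  refine ⟨fun x => ∫⁻ y, ENNReal.ofReal (klFun (Kernel.rnDeriv κ η x y).toReal) ∂η x,
    hmk.lintegral_kernel_prod_right', ?_, ?_⟩
  · filter_upwards [hae] with x hx
    rw [klDiv_eq_lintegral_klFun_of_ac hx]
    refine (lintegral_congr_ae ?_).le
    filter_upwards [Kernel.rnDeriv_eq_rnDeriv_measure (κ := κ) (η := η) (a := x)] with y hy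
    rw [hy]
  · rw [klDiv_eq_lintegral_klFun_of_ac hac, ← Measure.lintegral_compProd hmk]
    refine (lintegral_congr_ae ?_).le
    filter_upwards [hrn] with p hp
    rw [hp]

/-- The expected divergence of conditional laws is at most the divergence of the joint laws. -/
lemma lintegral_klDiv_condDistrib_le {Ω : Type*} {mΩ : MeasurableSpace Ω} {P : Measure Ω}
    [IsProbabilityMeasure P] [StandardBorelSpace β] [Nonempty β] {X X' : Ω → α} {Y Y' : Ω → β}
    (hX : Measurable X) (hX' : Measurable X') (hY : Measurable Y) (hY' : Measurable Y') :
    ∫⁻ ω, klDiv (condDistrib Y X P (X ω)) (condDistrib Y' X' P (X ω)) ∂P ≤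
      klDiv (P.map fun ω => (X ω, Y ω)) (P.map fun ω => (X' ω, Y' ω)) := by
  have := Measure.isProbabilityMeasure_map (μ := P) hX.aemeasurable
  have := Measure.isProbabilityMeasure_map (μ := P) hX'.aemeasurable
  obtain ⟨h, hm, hle, hint⟩ :=
    exists_measurable_ge_klDiv (P.map X) (condDistrib Y X P) (condDistrib Y' X' P)
  calc ∫⁻ ω, klDiv (condDistrib Y X P (X ω)) (condDistrib Y' X' P (X ω)) ∂P
      ≤ ∫⁻ ω, h (X ω) ∂P := lintegral_mono_ae (ae_of_ae_map hX.aemeasurable hle)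
    _ = ∫⁻ x, h x ∂(P.map X) := (lintegral_map hm hX).symm
    _ ≤ _ := hint
    -- The divergence of the input laws, which may differ under feedback, is added for free to
    -- complete the chain rule.
    _ ≤ klDiv (P.map X) (P.map X') + klDiv (P.map X ⊗ₘ condDistrib Y X P)
          (P.map X ⊗ₘ condDistrib Y' X' P) := le_add_self
    _ = _ := by
      rw [← klDiv_compProd_eq_add, compProd_map_condDistrib hY.aemeasurable,
        compProd_map_condDistrib hY'.aemeasurable]

lemma klDiv_withDensity_ofReal {M : Measure α} {f g : α → ℝ} (hf : Measurable f)
    (hg : Measurable g) (hf0 : ∀ x, 0 < f x) (hg0 : ∀ x, 0 < g x)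
    [hP : IsProbabilityMeasure (M.withDensity fun x => ENNReal.ofReal (f x))]
    [hQ : IsProbabilityMeasure (M.withDensity fun x => ENNReal.ofReal (g x))]
    (hint : Integrable (fun x => Real.log (f x) - Real.log (g x))
      (M.withDensity fun x => ENNReal.ofReal (f x))) :
    klDiv (M.withDensity fun x => ENNReal.ofReal (f x))
        (M.withDensity fun x => ENNReal.ofReal (g x)) =
      ENNReal.ofReal (∫ x, Real.log (f x) - Real.log (g x)
        ∂(M.withDensity fun x => ENNReal.ofReal (f x))) := by
  have hmul : (M.withDensity fun x => ENNReal.ofReal (f x)) =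
      (M.withDensity fun x => ENNReal.ofReal (g x)).withDensity
        fun x => ENNReal.ofReal (f x / g x) := by
    rw [← withDensity_mul _ (by fun_prop) (by fun_prop)]
    congr 1
    ext x
    rw [Pi.mul_apply, ← ENNReal.ofReal_mul (hg0 x).le, mul_div_cancel₀ _ (hg0 x).ne']
  have hac : (M.withDensity fun x => ENNReal.ofReal (f x)) ≪
      (M.withDensity fun x => ENNReal.ofReal (g x)) := by
    rw [hmul]
    exact withDensity_absolutelyContinuous _ _
  have hllr : llr (M.withDensity fun x => ENNReal.ofReal (f x))
      (M.withDensity fun x => ENNReal.ofReal (g x))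
      =ᵐ[M.withDensity fun x => ENNReal.ofReal (f x)]
      fun x => Real.log (f x) - Real.log (g x) := by
    refine hac.ae_le ?_
    have hrn := Measure.rnDeriv_withDensity (M.withDensity fun x => ENNReal.ofReal (g x))
      (f := fun x => ENNReal.ofReal (f x / g x)) (by fun_prop)
    rw [← hmul] at hrn
    filter_upwards [hrn] with x hx
    rw [llr, hx, ENNReal.toReal_ofReal (div_pos (hf0 x) (hg0 x)).le,
      Real.log_div (hf0 x).ne' (hg0 x).ne']
  -- Both measures are probabilities, so the mass correction in `klDiv` cancels.
  rw [klDiv_of_ac_of_integrable hac ((integrable_congr hllr).2 hint), integral_congr_ae hllr]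
  simp

end CondKL

/-! ### Joint law in a feedback loop -/

section ClosedLoop

lemma map_withDensity_comp {α β : Type*} {mα : MeasurableSpace α} {mβ : MeasurableSpace β}
    (μ : Measure α) {f : α → β} (hf : Measurable f) {g : β → ℝ≥0∞} (hg : Measurable g) :
    (μ.withDensity fun x => g (f x)).map f = (μ.map f).withDensity g := by
  ext s hs
  rw [Measure.map_apply hf hs, withDensity_apply _ (hf hs), withDensity_apply _ hs,
    setLIntegral_map hs hg hf]

/-- The determinant is the characteristic polynomial `X ^ d` of a nilpotent map, evaluated at `1`.
-/
lemma det_one_sub_of_isNilpotent {F : Type*} [AddCommGroup F] [Module ℝ F] [FiniteDimensional ℝ F]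
    {A : F →ₗ[ℝ] F} (hA : IsNilpotent A) : LinearMap.det (1 - A) = 1 := by
  have h := LinearMap.eval_charpoly A 1
  rw [IsNilpotent.charpoly_eq_X_pow_finrank hA] at h
  simpa using h.symm

variable {Ω F H : Type*} {mΩ : MeasurableSpace Ω} {P : Measure Ω} [IsProbabilityMeasure P]
  [NormedAddCommGroup F] [NormedSpace ℝ F] [FiniteDimensional ℝ F] [MeasurableSpace F]
  [BorelSpace F] [NormedAddCommGroup H] [NormedSpace ℝ H] [FiniteDimensional ℝ H]
  [MeasurableSpace H] [BorelSpace H]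

/-- In the feedback loop `Y = T U + V`, `U = K Y + W` with a nilpotent loop operator `T K`, the
joint law of `(U, Y)` has the density `g (y - T u)` with respect to a measure that does not depend
on `T`. -/
lemma map_closedLoop_eq_withDensity (vol : Measure F) [vol.IsAddHaarMeasure] {V Y : Ω → F}
    {W U : Ω → H} (hV : Measurable V) (hW : Measurable W) (hVW : IndepFun W V P)
    {T : H →ₗ[ℝ] F} {K : F →ₗ[ℝ] H} (hTK : IsNilpotent (T ∘ₗ K)) {g : F → ℝ≥0∞}
    (hg : Measurable g) (hlaw : P.map V = vol.withDensity g) (hU : ∀ ω, U ω = K (Y ω) + W ω)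
    (hY : ∀ ω, Y ω = T (U ω) + V ω) :
    P.map (fun ω => (U ω, Y ω)) =
      (((P.map W).prod vol).map fun x => (K x.2 + x.1, x.2)).withDensity
        fun x => g (x.2 - T x.1) := by
  have hT : Continuous T := T.continuous_of_finiteDimensional
  have hK : Continuous K := K.continuous_of_finiteDimensional
  have := Measure.isProbabilityMeasure_map (μ := P) hW.aemeasurable
  have hdet := det_one_sub_of_isNilpotent hTK
  -- Eliminating `U` from the loop equations gives `(1 - T K) Y = T W + V`.
  set e : F ≃ₗ[ℝ] F := LinearMap.equivOfDetNeZero (1 - T ∘ₗ K) (by rw [hdet]; exact one_ne_zero)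
  have he : ∀ x, e x = x - T (K x) := fun x => rfl
  have hes : Continuous e.symm := (e.symm : F →ₗ[ℝ] F).continuous_of_finiteDimensional
  have hpres : MeasurePreserving (e.symm : F → F) vol vol := by
    refine ⟨hes.measurable, ?_⟩
    have hd : LinearMap.det (e.symm : F →ₗ[ℝ] F) = 1 := by
      have h1 := LinearEquiv.det_symm_mul_det e
      have h2 : LinearMap.det (e : F →ₗ[ℝ] F) = 1 := hdet
      rwa [h2, mul_one] at h1
    have := Measure.map_linearMap_addHaar_eq_smul_addHaar vol (f := (e.symm : F →ₗ[ℝ] F))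
      (by rw [hd]; exact one_ne_zero)
    rw [hd] at this
    simpa using this
  set ξ : H × F → H × F := fun x => (x.1, e.symm (T x.1 + x.2)) with hξ
  have hξm : Measurable ξ := by fun_prop
  -- For fixed `w` the map is a translation followed by a linear map of determinant one, so the skew
  -- product preserves the reference measure.
  have hξpres : MeasurePreserving ξ ((P.map W).prod vol) ((P.map W).prod vol) := by
    refine (MeasurePreserving.id _).skew_product (g := fun w v => e.symm (T w + v))
      (by unfold Function.uncurry; fun_prop) (ae_of_all _ fun w => ?_)
    exact (hpres.comp (measurePreserving_add_left vol (T w))).map_eq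
  have hYe : ∀ ω, (W ω, Y ω) = ξ (W ω, V ω) := by
    intro ω
    simp only [hξ, Prod.mk.injEq, true_and]
    have h := hY ω
    rw [hU ω, map_add] at h
    rw [LinearEquiv.eq_symm_apply, he, sub_eq_iff_eq_add]
    exact h.trans (by abel)
  have hWV : P.map (fun ω => (W ω, V ω)) =
      ((P.map W).prod vol).withDensity fun x => g (x.2) := by
    rw [(indepFun_iff_map_prod_eq_prod_map_map hW.aemeasurable hV.aemeasurable).1 hVW, hlaw]
    exact prod_withDensity_right hg
  have hWY : P.map (fun ω => (W ω, Y ω)) =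
      ((P.map W).prod vol).withDensity fun x => g (x.2 - T (K x.2 + x.1)) := by
    have h1 : P.map (fun ω => (W ω, Y ω)) = (P.map (fun ω => (W ω, V ω))).map ξ := by
      rw [Measure.map_map hξm (by fun_prop)]
      exact congrArg (fun f => P.map f) (funext hYe)
    rw [h1, hWV]
    conv_rhs => rw [← hξpres.map_eq]
    rw [← map_withDensity_comp _ hξm (by fun_prop)]
    congr 2
    ext x
    congr 1
    have := he (ξ x).2
    simp only [hξ, LinearEquiv.apply_symm_apply] at this ⊢
    rw [LinearMap.map_add T, ← sub_sub, ← this]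
    abel
  have hΘ : Measurable fun x : H × F => (K x.2 + x.1, x.2) := by fun_prop
  have hYm : Measurable fun ω => (W ω, Y ω) := by
    have : (fun ω => (W ω, Y ω)) = fun ω => ξ (W ω, V ω) := funext hYe
    rw [this]
    fun_prop
  have h2 : P.map (fun ω => (U ω, Y ω)) =
      (P.map fun ω => (W ω, Y ω)).map fun x => (K x.2 + x.1, x.2) := by
    rw [Measure.map_map hΘ hYm]
    refine congrArg (fun f => P.map f) (funext fun ω => ?_)
    simp [hU ω]
  rw [h2, hWY]
  exact map_withDensity_comp (g := fun x : H × F => g (x.2 - T x.1)) _ hΘ (by fun_prop)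

end ClosedLoop

/-! ### Gaussian densities -/

lemma pi_withDensity_ofReal {ι E : Type*} [Fintype ι] {mE : MeasurableSpace E} {ν : Measure E}
    [SigmaFinite ν] {f : E → ℝ} (hf0 : ∀ x, 0 ≤ f x) (hint : Integrable f ν) :
    Measure.pi (fun _ : ι => ν.withDensity fun x => ENNReal.ofReal (f x)) =
      (Measure.pi fun _ : ι => ν).withDensity fun x => ENNReal.ofReal (∏ i, f (x i)) := by
  have : IsFiniteMeasure (ν.withDensity fun x => ENNReal.ofReal (f x)) :=
    isFiniteMeasure_withDensity_ofReal hint.2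
  refine Measure.pi_eq fun s hs => ?_
  rw [withDensity_apply _ (MeasurableSet.univ_pi hs), Measure.restrict_pi_pi,
    ← ofReal_integral_eq_lintegral_ofReal
      (Integrable.fintype_prod_dep (f := fun _ => f) fun i => hint.restrict)
      (ae_of_all _ fun x => Finset.prod_nonneg fun i _ => hf0 _),
    integral_fintype_prod_eq_prod (fun _ => f),
    ENNReal.ofReal_prod_of_nonneg fun i _ => integral_nonneg hf0]
  refine Finset.prod_congr rfl fun i _ => ?_
  rw [withDensity_apply _ (hs i),
    ofReal_integral_eq_lintegral_ofReal hint.restrict (ae_of_all _ hf0)]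

/-- The constant may stay anonymous, since it cancels in likelihood ratios. -/
lemma exists_stdGaussian_eq_withDensity (p : ℕ) : ∃ c : ℝ, 0 < c ∧
    stdGaussian (EuclideanSpace ℝ (Fin p)) =
      volume.withDensity fun x => ENNReal.ofReal (c * Real.exp (-(‖x‖ ^ 2) / 2)) := by
  refine ⟨(Real.sqrt (2 * Real.pi))⁻¹ ^ p, by positivity, ?_⟩
  have h1 : ∀ x : Fin p → ℝ, ∏ i, gaussianPDFReal 0 1 (x i) =
      (Real.sqrt (2 * Real.pi))⁻¹ ^ p * Real.exp (-(‖WithLp.toLp 2 x‖ ^ 2) / 2) := by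
    intro x
    simp only [gaussianPDFReal, NNReal.coe_one, mul_one, sub_zero]
    rw [Finset.prod_mul_distrib, Finset.prod_const, Finset.card_univ, Fintype.card_fin,
      ← Real.exp_sum, EuclideanSpace.real_norm_sq_eq]
    simp only [neg_div, Finset.sum_neg_distrib, Finset.sum_div]
  have hpi := pi_withDensity_ofReal (ι := Fin p) (ν := (volume : Measure ℝ))
    (gaussianPDFReal_nonneg 0 1) (integrable_gaussianPDFReal 0 1)
  have hg : (volume : Measure ℝ).withDensity (fun x => ENNReal.ofReal (gaussianPDFReal 0 1 x)) =
      gaussianReal 0 1 := (gaussianReal_of_var_ne_zero 0 one_ne_zero).symm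
  simp only [hg, h1] at hpi
  rw [← map_pi_eq_stdGaussian, hpi]
  have hmp := PiLp.volume_preserving_toLp (Fin p)
  refine (map_withDensity_comp _ hmp.measurable (g := fun x => ENNReal.ofReal
    ((Real.sqrt (2 * Real.pi))⁻¹ ^ p * Real.exp (-(‖x‖ ^ 2) / 2))) (by fun_prop)).trans ?_
  rw [← hmp.map_eq]
  rfl

open scoped MatrixOrder in
-- The law is the image of the standard Gaussian under `A = √S`. Since `A * S⁻¹ * A = 1`, the
-- exponent becomes the form of `S⁻¹`, and the Jacobian goes into the constant.
lemma exists_multivariateGaussian_eq_withDensity {p : ℕ} {S : Matrix (Fin p) (Fin p) ℝ}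
    (hS : S.PosDef) : ∃ c : ℝ, 0 < c ∧ multivariateGaussian 0 S =
      volume.withDensity fun x : EuclideanSpace ℝ (Fin p) =>
        ENNReal.ofReal (c * Real.exp (-(x.ofLp ⬝ᵥ S⁻¹ *ᵥ x.ofLp) / 2)) := by
  obtain ⟨c, hc, hstd⟩ := exists_stdGaussian_eq_withDensity p
  set A := CFC.sqrt S with hA
  have hAA : A * A = S := CFC.sqrt_mul_sqrt_self S hS.posSemidef.nonneg
  have hsymm : Aᵀ = A := by
    have h := (CFC.sqrt_nonneg S).isSelfAdjoint
    rw [IsSelfAdjoint, Matrix.star_eq_conjTranspose, Matrix.conjTranspose_eq_transpose_of_trivial]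
      at h
    exact h
  have hSdet : IsUnit S.det := hS.det_pos.ne'.isUnit
  have hAdet : IsUnit A.det := by
    rw [← hAA, Matrix.det_mul] at hSdet
    exact isUnit_of_mul_isUnit_left hSdet
  have hinv : A * S⁻¹ * A = 1 := by
    rw [← hAA, Matrix.mul_inv_rev, ← Matrix.mul_assoc, Matrix.mul_nonsing_inv _ hAdet,
      Matrix.one_mul, Matrix.nonsing_inv_mul _ hAdet]
  set L : EuclideanSpace ℝ (Fin p) →L[ℝ] EuclideanSpace ℝ (Fin p) :=
    Matrix.toEuclideanCLM (𝕜 := ℝ) A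
  have hLx : ∀ x, (L x).ofLp = A *ᵥ x.ofLp := fun x => rfl
  have hquad : ∀ x, (L x).ofLp ⬝ᵥ S⁻¹ *ᵥ (L x).ofLp = ‖x‖ ^ 2 := by
    intro x
    rw [hLx, Matrix.mulVec_mulVec, ← Matrix.vecMul_transpose, hsymm, ← Matrix.dotProduct_mulVec,
      Matrix.mulVec_mulVec, ← Matrix.mul_assoc, hinv, Matrix.one_mulVec,
      EuclideanSpace.real_norm_sq_eq]
    exact Finset.sum_congr rfl fun i _ => by ring
  have hdet : LinearMap.det (L : EuclideanSpace ℝ (Fin p) →ₗ[ℝ] EuclideanSpace ℝ (Fin p)) ≠ 0 := by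
    have hinj : Function.Injective (L : EuclideanSpace ℝ (Fin p) →ₗ[ℝ] EuclideanSpace ℝ (Fin p)) := by
      rw [← LinearMap.ker_eq_bot, LinearMap.ker_eq_bot']
      intro x hx
      have h := hquad x
      have hx' : L x = 0 := hx
      rw [hx'] at h
      simpa using h.symm
    have := (LinearMap.isUnit_iff_ker_eq_bot _).2 (LinearMap.ker_eq_bot.2 hinj)
    exact ((LinearMap.isUnit_iff_isUnit_det _).1 this).ne_zero
  refine ⟨|(LinearMap.det (L : EuclideanSpace ℝ (Fin p) →ₗ[ℝ] EuclideanSpace ℝ (Fin p)))⁻¹| * c,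
    by positivity, ?_⟩
  have hmap := Measure.map_linearMap_addHaar_eq_smul_addHaar
    (volume : Measure (EuclideanSpace ℝ (Fin p))) hdet
  have hm : Measurable fun x : EuclideanSpace ℝ (Fin p) =>
      ENNReal.ofReal (c * Real.exp (-(x.ofLp ⬝ᵥ S⁻¹ *ᵥ x.ofLp) / 2)) := by
    simp only [dotProduct, Matrix.mulVec]
    fun_prop
  rw [multivariateGaussian, hstd]
  simp only [zero_add]
  have h1 := map_withDensity_comp (volume : Measure (EuclideanSpace ℝ (Fin p))) (f := L)
    L.continuous.measurable hm
  simp only [hquad] at h1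
  refine h1.trans ?_
  have h2 : Measure.map L (volume : Measure (EuclideanSpace ℝ (Fin p))) = _ := hmap
  rw [h2, withDensity_smul_measure, ← withDensity_smul _ hm]
  congr 1
  ext x
  rw [Pi.smul_apply, smul_eq_mul, ← ENNReal.ofReal_mul (abs_nonneg _), mul_assoc]

/-- The density of a Gaussian white noise sequence. -/
lemma exists_map_noise_eq_withDensity {Ω : Type*} {mΩ : MeasurableSpace Ω} {P : Measure Ω}
    [IsProbabilityMeasure P] {p N : ℕ} {S : Matrix (Fin p) (Fin p) ℝ} (hS : S.PosDef)
    {v : Fin N → Ω → EuclideanSpace ℝ (Fin p)} (hv : ∀ t, Measurable (v t))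
    (hlaw : ∀ t, P.map (v t) = multivariateGaussian 0 S) (hind : iIndepFun v P) :
    ∃ c : ℝ, 0 < c ∧ P.map (fun ω t => v t ω) =
      volume.withDensity fun x : Fin N → EuclideanSpace ℝ (Fin p) =>
        ENNReal.ofReal (c * Real.exp (-(∑ t, (x t).ofLp ⬝ᵥ S⁻¹ *ᵥ (x t).ofLp) / 2)) := by
  obtain ⟨c, hc, hd⟩ := exists_multivariateGaussian_eq_withDensity hS
  refine ⟨c ^ N, by positivity, ?_⟩
  have hm : Measurable fun x : EuclideanSpace ℝ (Fin p) =>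
      c * Real.exp (-(x.ofLp ⬝ᵥ S⁻¹ *ᵥ x.ofLp) / 2) := by
    simp only [dotProduct, Matrix.mulVec]
    fun_prop
  have hint : Integrable (fun x : EuclideanSpace ℝ (Fin p) =>
      c * Real.exp (-(x.ofLp ⬝ᵥ S⁻¹ *ᵥ x.ofLp) / 2)) volume := by
    refine ⟨hm.aestronglyMeasurable, ?_⟩
    rw [hasFiniteIntegral_iff_ofReal (ae_of_all _ fun x => by positivity),
      ← setLIntegral_univ, ← withDensity_apply _ MeasurableSet.univ, ← hd]
    exact measure_lt_top _ _
  rw [(iIndepFun_iff_map_fun_eq_pi_map fun t => (hv t).aemeasurable).1 hind]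
  simp only [hlaw, hd]
  rw [pi_withDensity_ofReal (fun x => by positivity) hint]
  refine congrArg _ (funext fun x => ?_)
  rw [Finset.prod_mul_distrib, Finset.prod_const, Finset.card_univ, Fintype.card_fin,
    ← Real.exp_sum]
  simp only [neg_div, Finset.sum_neg_distrib, Finset.sum_div]

/-! ### Second moments of filtered stationary signals -/

/-- Cauchy–Schwarz over index pairs. Asking only for equal moduli covers both `y = x` and `y = conj
x`, that is, real quadratic and Hermitian forms. -/
lemma norm_sum_bilin_le_frobNorm {𝕜 : Type*} [RCLike 𝕜] {m : ℕ} (A : Matrix (Fin m) (Fin m) 𝕜)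
    {x y : Fin m → 𝕜} (hxy : ∀ a, ‖y a‖ = ‖x a‖) :
    ‖∑ a, ∑ b, A a b * (x a * y b)‖ ≤ frobNorm A * ∑ a, ‖x a‖ ^ 2 := by
  calc ‖∑ a, ∑ b, A a b * (x a * y b)‖
      ≤ ∑ a, ∑ b, ‖A a b‖ * (‖x a‖ * ‖x b‖) := by
        refine (norm_sum_le _ _).trans (Finset.sum_le_sum fun a _ => (norm_sum_le _ _).trans
          (Finset.sum_le_sum fun b _ => ?_))
        rw [norm_mul, norm_mul, hxy]
    _ = ∑ ab : Fin m × Fin m, ‖A ab.1 ab.2‖ * (‖x ab.1‖ * ‖x ab.2‖) := by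
        rw [Fintype.sum_prod_type]
    _ ≤ Real.sqrt (∑ ab : Fin m × Fin m, ‖A ab.1 ab.2‖ ^ 2) *
          Real.sqrt (∑ ab : Fin m × Fin m, (‖x ab.1‖ * ‖x ab.2‖) ^ 2) :=
        Real.sum_mul_le_sqrt_mul_sqrt _ _ _
    _ = frobNorm A * ∑ a, ‖x a‖ ^ 2 := by
        rw [Fintype.sum_prod_type, Fintype.sum_prod_type, frobNorm]
        congr 1
        rw [Real.sqrt_eq_iff_mul_self_eq (by positivity) (by positivity), Finset.sum_mul_sum]
        simp only [mul_pow]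

lemma intervalIntegrable_finsetSum {ι E : Type*} [NormedAddCommGroup E] (s : Finset ι)
    {f : ι → ℝ → E} {a b : ℝ} (h : ∀ i ∈ s, IntervalIntegrable (f i) volume a b) :
    IntervalIntegrable (fun x => ∑ i ∈ s, f i x) volume a b := by
  have h1 : (fun x => ∑ i ∈ s, f i x) = ∑ i ∈ s, f i := by
    ext x
    rw [Finset.sum_apply]
  rw [h1]
  exact IntervalIntegrable.sum s h

section Moments

variable {Ω : Type*} {mΩ : MeasurableSpace Ω} {P : Measure Ω} {p m : ℕ}
  {u : ℕ → Ω → EuclideanSpace ℝ (Fin m)}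

/-- A negative lag is reduced to a positive one by exchanging the two factors, in accordance with
the two `toNat`s in `autocorr`. -/
lemma IsStationary.integral_mul (hu : IsStationary P u) (s r : ℕ) (a b : Fin m) :
    ∫ ω, u s ω a * u r ω b ∂P = autocorr P u ((s : ℤ) - r) a b := by
  rw [autocorr, Matrix.of_apply]
  rcases le_total r s with h | h
  · obtain ⟨k, rfl⟩ := Nat.exists_eq_add_of_le h
    have h1 : (((r + k : ℕ) : ℤ) - r).toNat = k := by omega
    have h2 : (-(((r + k : ℕ) : ℤ) - r)).toNat = 0 := by omega
    rw [h1, h2, hu.2]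
  · obtain ⟨k, rfl⟩ := Nat.exists_eq_add_of_le h
    have h1 : ((s : ℤ) - ((s + k : ℕ) : ℤ)).toNat = 0 := by omega
    have h2 : (-((s : ℤ) - ((s + k : ℕ) : ℤ))).toNat = k := by omega
    rw [h1, h2]
    simp only [mul_comm (u s _ a), mul_comm (u 0 _ a)]
    exact hu.2 s k b a

lemma IsStationary.memLp_apply (hu : IsStationary P u) (s : ℕ) (a : Fin m) :
    MemLp (fun ω => u s ω a) 2 P :=
  (EuclideanSpace.proj (𝕜 := ℝ) a).comp_memLp' (hu.1 s)

lemma IsStationary.integrable_mul (hu : IsStationary P u) (s r : ℕ) (a b : Fin m) :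
    Integrable (fun ω => u s ω a * u r ω b) P :=
  (hu.memLp_apply s a).integrable_mul (hu.memLp_apply r b)

lemma sum_act_apply (D : ℕ → Matrix (Fin p) (Fin m) ℝ) (s : Finset ℕ)
    (x : ℕ → EuclideanSpace ℝ (Fin m)) (i : Fin p) :
    (∑ l ∈ s, act (D l) (x l)) i = ∑ l ∈ s, ∑ a, D l i a * x l a := by
  simp [act, Matrix.mulVec, dotProduct]

lemma norm_sum_act_sq (D : ℕ → Matrix (Fin p) (Fin m) ℝ) (s : Finset ℕ)
    (x : ℕ → EuclideanSpace ℝ (Fin m)) :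
    ‖∑ l ∈ s, act (D l) (x l)‖ ^ 2 =
      ∑ i, ∑ a, ∑ b, ∑ l ∈ s, ∑ k ∈ s, D l i a * D k i b * (x l a * x k b) := by
  rw [EuclideanSpace.real_norm_sq_eq]
  refine Finset.sum_congr rfl fun i _ => ?_
  have h : ∀ z : ℕ → Fin m → ℝ, ∑ l ∈ s, ∑ a, z l a = ∑ a, ∑ l ∈ s, z l a :=
    fun z => Finset.sum_comm
  rw [sum_act_apply, pow_two, h, Finset.sum_mul_sum]
  refine Finset.sum_congr rfl fun a _ => Finset.sum_congr rfl fun b _ => ?_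
  rw [Finset.sum_mul_sum]
  exact Finset.sum_congr rfl fun l _ => Finset.sum_congr rfl fun k _ => by ring

/-- The power of a filtered stationary signal, in the frequency domain. -/
lemma integral_norm_sum_act_sq (hu : IsStationary P u) {Φ : ℝ → Matrix (Fin m) (Fin m) ℂ}
    (hΦ : IsSpectralDensity (autocorr P u) Φ) (D : ℕ → Matrix (Fin p) (Fin m) ℝ) {s : Finset ℕ}
    {t : ℕ} (hs : ∀ l ∈ s, l ≤ t) :
    ((∫ ω, ‖∑ l ∈ s, act (D l) (u (t - l) ω)‖ ^ 2 ∂P : ℝ) : ℂ) =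
      ((2 * Real.pi : ℝ) : ℂ)⁻¹ * ∫ ω in (-Real.pi)..Real.pi, ∑ i, ∑ a, ∑ b, Φ ω a b *
        ((starRingEnd ℂ) (∑ l ∈ s, (D l i a : ℂ) * Complex.exp (-(l * ω * Complex.I))) *
          ∑ k ∈ s, (D k i b : ℂ) * Complex.exp (-(k * ω * Complex.I))) := by
  have hterm : ∀ i a b, IntervalIntegrable (fun ω : ℝ => Φ ω a b *
        ((starRingEnd ℂ) (∑ l ∈ s, (D l i a : ℂ) * Complex.exp (-(l * ω * Complex.I))) *
          ∑ k ∈ s, (D k i b : ℂ) * Complex.exp (-(k * ω * Complex.I))))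
      volume (-Real.pi) Real.pi := fun i a b =>
    (hΦ.1 a b).mul_continuousOn (Continuous.continuousOn (by fun_prop))
  have hexp : ∀ a b (k : ℤ), IntervalIntegrable (fun ω : ℝ => Φ ω a b *
      Complex.exp (-(k * ω * Complex.I))) volume (-Real.pi) Real.pi := fun a b k =>
    (hΦ.1 a b).mul_continuousOn (Continuous.continuousOn (by fun_prop))
  simp only [norm_sum_act_sq]
  rw [integral_finsetSum _ fun i _ => integrable_finsetSum _ fun a _ =>
    integrable_finsetSum _ fun b _ => integrable_finsetSum _ fun l _ =>
    integrable_finsetSum _ fun k _ => (hu.integrable_mul _ _ a b).const_mul _,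
    intervalIntegral.integral_finsetSum fun i _ => intervalIntegrable_finsetSum _ fun a _ =>
      intervalIntegrable_finsetSum _ fun b _ => hterm i a b, Finset.mul_sum, Complex.ofReal_sum]
  refine Finset.sum_congr rfl fun i _ => ?_
  rw [integral_finsetSum _ fun a _ =>
    integrable_finsetSum _ fun b _ => integrable_finsetSum _ fun l _ =>
    integrable_finsetSum _ fun k _ => (hu.integrable_mul _ _ a b).const_mul _,
    intervalIntegral.integral_finsetSum fun a _ =>
      intervalIntegrable_finsetSum _ fun b _ => hterm i a b, Finset.mul_sum, Complex.ofReal_sum]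
  refine Finset.sum_congr rfl fun a _ => ?_
  rw [integral_finsetSum _ fun b _ => integrable_finsetSum _ fun l _ =>
    integrable_finsetSum _ fun k _ => (hu.integrable_mul _ _ a b).const_mul _,
    intervalIntegral.integral_finsetSum fun b _ => hterm i a b, Finset.mul_sum, Complex.ofReal_sum]
  refine Finset.sum_congr rfl fun b _ => ?_
  rw [integral_finsetSum _ fun l _ =>
    integrable_finsetSum _ fun k _ => (hu.integrable_mul _ _ a b).const_mul _, Complex.ofReal_sum]
  have hpt : ∀ ω : ℝ, Φ ω a b *
        ((starRingEnd ℂ) (∑ l ∈ s, (D l i a : ℂ) * Complex.exp (-(l * ω * Complex.I))) *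
          ∑ k ∈ s, (D k i b : ℂ) * Complex.exp (-(k * ω * Complex.I))) =
      ∑ l ∈ s, ∑ k ∈ s, ((D l i a * D k i b : ℝ) : ℂ) *
        (Φ ω a b * Complex.exp (-((((k : ℤ) - (l : ℤ) : ℤ) : ℂ) * ω * Complex.I))) := by
    intro ω
    rw [map_sum, Finset.sum_mul_sum, Finset.mul_sum]
    refine Finset.sum_congr rfl fun l _ => ?_
    rw [Finset.mul_sum]
    refine Finset.sum_congr rfl fun k _ => ?_
    rw [map_mul, conj_cexp_mul, Complex.conj_ofReal]
    have : Complex.exp (-((((k : ℤ) - (l : ℤ) : ℤ) : ℂ) * ω * Complex.I)) =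
        Complex.exp (l * ω * Complex.I) * Complex.exp (-(k * ω * Complex.I)) := by
      rw [← Complex.exp_add]
      congr 1
      push_cast
      ring
    rw [this]
    push_cast
    ring
  simp_rw [hpt]
  rw [intervalIntegral.integral_finsetSum fun l _ => intervalIntegrable_finsetSum _ fun k _ =>
    (hexp a b _).const_mul _, Finset.mul_sum]
  refine Finset.sum_congr rfl fun l hl => ?_
  rw [integral_finsetSum _ fun k _ => (hu.integrable_mul _ _ a b).const_mul _, Complex.ofReal_sum,
    intervalIntegral.integral_finsetSum fun k _ => (hexp a b _).const_mul _, Finset.mul_sum]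
  refine Finset.sum_congr rfl fun k hk => ?_
  rw [integral_const_mul, intervalIntegral.integral_const_mul, mul_left_comm, hΦ.2,
    Complex.ofReal_mul, hu.integral_mul]
  -- The truncated subtractions are exact because `l` and `k` are at most `t`; the lag then no
  -- longer depends on `t`.
  have : ((t - l : ℕ) : ℤ) - (t - k : ℕ) = (k : ℤ) - l := by
    have := hs l hl
    have := hs k hk
    omega
  rw [this]

lemma ae_frobNorm_le_essSupNorm {Φ : ℝ → Matrix (Fin m) (Fin m) ℂ} (hb : essSupNorm Φ < ∞) :
    ∀ᵐ ω ∂(volume.restrict (Set.Ioc (-Real.pi) Real.pi)),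
      frobNorm (Φ ω) ≤ (essSupNorm Φ).toReal := by
  filter_upwards [ENNReal.ae_le_essSup fun ω => ENNReal.ofReal (frobNorm (Φ ω))] with ω hω
  exact (ENNReal.ofReal_le_iff_le_toReal hb.ne).1 hω

/-- For each output coordinate the integrand is a Hermitian form of `Φ ω` in the filter's frequency
response. Bounding it by `‖Φ ω‖` leaves a mean square that Parseval evaluates. -/
lemma integral_norm_sum_act_sq_le (hu : IsStationary P u) {Φ : ℝ → Matrix (Fin m) (Fin m) ℂ}
    (hΦ : IsSpectralDensity (autocorr P u) Φ) (hb : essSupNorm Φ < ∞)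
    (D : ℕ → Matrix (Fin p) (Fin m) ℝ) {s : Finset ℕ} {t : ℕ} (hs : ∀ l ∈ s, l ≤ t) :
    ∫ ω, ‖∑ l ∈ s, act (D l) (u (t - l) ω)‖ ^ 2 ∂P ≤
      (essSupNorm Φ).toReal * ∑ l ∈ s, frobNorm (D l) ^ 2 := by
  set Q : Fin p → Fin m → ℝ → ℂ := fun i a ω =>
    ∑ l ∈ s, (D l i a : ℂ) * Complex.exp (-(l * ω * Complex.I)) with hQ
  have hQc : ∀ i a, Continuous (Q i a) := fun i a => by fun_prop
  have hpi : -Real.pi ≤ Real.pi := by linarith [Real.pi_pos]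
  have h0 : 0 ≤ ∫ ω, ‖∑ l ∈ s, act (D l) (u (t - l) ω)‖ ^ 2 ∂P :=
    integral_nonneg fun ω => by positivity
  have hkey := integral_norm_sum_act_sq hu hΦ D hs
  rw [← Real.norm_of_nonneg h0, ← Complex.norm_real, hkey, norm_mul, norm_inv, Complex.norm_real,
    Real.norm_of_nonneg Real.two_pi_pos.le]
  have hbound : ∀ᵐ ω ∂(volume.restrict (Set.Ioc (-Real.pi) Real.pi)),
      ‖∑ i, ∑ a, ∑ b, Φ ω a b * ((starRingEnd ℂ) (Q i a ω) * Q i b ω)‖ ≤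
        (essSupNorm Φ).toReal * ∑ i, ∑ a, ‖Q i a ω‖ ^ 2 := by
    filter_upwards [ae_frobNorm_le_essSupNorm hb] with ω hω
    rw [Finset.mul_sum]
    refine (norm_sum_le _ _).trans (Finset.sum_le_sum fun i _ => ?_)
    refine (norm_sum_bilin_le_frobNorm (Φ ω) (x := fun a => (starRingEnd ℂ) (Q i a ω))
      (y := fun b => Q i b ω) fun a => (RCLike.norm_conj _).symm).trans ?_
    simp only [RCLike.norm_conj]
    exact mul_le_mul_of_nonneg_right hω (by positivity)
  have hint := intervalIntegral.norm_integral_le_of_norm_le (μ := volume) hpi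
    ((ae_restrict_iff' measurableSet_Ioc).1 hbound)
    (Continuous.intervalIntegrable (by fun_prop) _ _)
  refine (mul_le_mul_of_nonneg_left hint (by positivity)).trans (le_of_eq ?_)
  have hi : ∀ i a, IntervalIntegrable (fun ω => ‖Q i a ω‖ ^ 2) volume (-Real.pi) Real.pi :=
    fun i a => Continuous.intervalIntegrable (by fun_prop) _ _
  rw [intervalIntegral.integral_const_mul, mul_left_comm,
    intervalIntegral.integral_finsetSum fun i _ => intervalIntegrable_finsetSum _ fun a _ => hi i a,
    Finset.mul_sum]
  congr 1
  simp only [frobNorm_sq]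
  rw [Finset.sum_comm]
  refine Finset.sum_congr rfl fun i _ => ?_
  rw [intervalIntegral.integral_finsetSum fun a _ => hi i a, Finset.mul_sum, Finset.sum_comm]
  refine Finset.sum_congr rfl fun a _ => ?_
  rw [hQ, mean_norm_sq_trigPoly s fun l => (D l i a : ℂ)]
  simp

end Moments

/-! ### The feedback loop on a finite horizon -/

section Loop

variable {p m : ℕ}

/-- A real matrix as a linear map of Euclidean spaces. -/
noncomputable def actLin (A : Matrix (Fin p) (Fin m) ℝ) :
    EuclideanSpace ℝ (Fin m) →ₗ[ℝ] EuclideanSpace ℝ (Fin p) where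
  toFun := act A
  map_add' x y := by simp [act, Matrix.mulVec_add]
  map_smul' c x := by simp [act, Matrix.mulVec_smul]

@[simp] lemma actLin_apply (A : Matrix (Fin p) (Fin m) ℝ) (x : EuclideanSpace ℝ (Fin m)) :
    actLin A x = act A x := rfl

lemma act_sub (A B : Matrix (Fin p) (Fin m) ℝ) (x : EuclideanSpace ℝ (Fin m)) :
    act (A - B) x = act A x - act B x := by
  simp [act, Matrix.sub_mulVec]

@[fun_prop] lemma measurable_act (A : Matrix (Fin p) (Fin m) ℝ) : Measurable (act A) :=
  (actLin A).continuous_of_finiteDimensional.measurable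

/-- The plant on a finite horizon: inputs at times `0, …, N - 1`, outputs at times `1, …, N`. -/
noncomputable def outputMap (H : ℕ → Matrix (Fin p) (Fin m) ℝ) (N : ℕ) :
    (Fin N → EuclideanSpace ℝ (Fin m)) →ₗ[ℝ] (Fin N → EuclideanSpace ℝ (Fin p)) :=
  LinearMap.pi fun t => ∑ s : Fin N,
    if s ≤ t then actLin (H (t + 1 - s)) ∘ₗ LinearMap.proj s else 0

/-- The controller on a finite horizon: outputs at times `1, …, N`, inputs at times
`0, …, N - 1`. -/
noncomputable def controlMap (K : ℕ → Matrix (Fin m) (Fin p) ℝ) (N : ℕ) :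
    (Fin N → EuclideanSpace ℝ (Fin p)) →ₗ[ℝ] (Fin N → EuclideanSpace ℝ (Fin m)) :=
  LinearMap.pi fun t => ∑ s : Fin N,
    if s < t then actLin (K (t - (s + 1))) ∘ₗ LinearMap.proj s else 0

lemma outputMap_apply (H : ℕ → Matrix (Fin p) (Fin m) ℝ) (N : ℕ)
    (x : Fin N → EuclideanSpace ℝ (Fin m)) (t : Fin N) :
    outputMap H N x t = ∑ s : Fin N, if s ≤ t then act (H (t + 1 - s)) (x s) else 0 := by
  rw [outputMap, LinearMap.pi_apply, LinearMap.sum_apply]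
  refine Finset.sum_congr rfl fun s _ => ?_
  split_ifs <;> simp

lemma controlMap_apply (K : ℕ → Matrix (Fin m) (Fin p) ℝ) (N : ℕ)
    (x : Fin N → EuclideanSpace ℝ (Fin p)) (t : Fin N) :
    controlMap K N x t = ∑ s : Fin N, if s < t then act (K (t - (s + 1))) (x s) else 0 := by
  rw [controlMap, LinearMap.pi_apply, LinearMap.sum_apply]
  refine Finset.sum_congr rfl fun s _ => ?_
  split_ifs <;> simp

lemma outputMap_seq (H : ℕ → Matrix (Fin p) (Fin m) ℝ) (N : ℕ)
    (x : ℕ → EuclideanSpace ℝ (Fin m)) (t : Fin N) :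
    outputMap H N (fun s => x s) t =
      ∑ l ∈ Finset.Icc 1 ((t : ℕ) + 1), act (H l) (x (t + 1 - l)) := by
  have ht := t.2
  rw [outputMap_apply]
  simp only [Fin.le_def]
  rw [Fin.sum_univ_eq_sum_range (fun s => if s ≤ (t : ℕ) then act (H (t + 1 - s)) (x s) else 0) N,
    ← Finset.sum_filter]
  refine Finset.sum_nbij' (fun s => t + 1 - s) (fun l => t + 1 - l) ?_ ?_ ?_ ?_ ?_ <;>
    simp only [Finset.mem_filter, Finset.mem_range, Finset.mem_Icc] <;> intro a ha
  · omega
  · omega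
  · omega
  · omega
  · rw [show (t : ℕ) + 1 - (t + 1 - a) = a by omega]

lemma controlMap_seq (K : ℕ → Matrix (Fin m) (Fin p) ℝ) (N : ℕ)
    (x : ℕ → EuclideanSpace ℝ (Fin p)) (t : Fin N) :
    controlMap K N (fun s => x (s + 1)) t =
      ∑ s ∈ Finset.Icc 1 (t : ℕ), act (K (t - s)) (x s) := by
  have ht := t.2
  rw [controlMap_apply]
  simp only [Fin.lt_def]
  rw [Fin.sum_univ_eq_sum_range
    (fun s => if s < (t : ℕ) then act (K (t - (s + 1))) (x (s + 1)) else 0) N,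
    ← Finset.sum_filter]
  refine Finset.sum_nbij' (fun s => s + 1) (fun l => l - 1) ?_ ?_ ?_ ?_ ?_ <;>
    simp only [Finset.mem_filter, Finset.mem_range, Finset.mem_Icc] <;> intro a ha
  · omega
  · omega
  · omega
  · omega
  · trivial

/-- The `k`-th power annihilates the first `k` coordinates, so the `N`-th power vanishes. -/
lemma isNilpotent_of_strictlyCausal {E : Type*} [AddCommGroup E] [Module ℝ E] {N : ℕ}
    {A : (Fin N → E) →ₗ[ℝ] (Fin N → E)} (hA : ∀ x t, (∀ s < t, x s = 0) → A x t = 0) :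
    IsNilpotent A := by
  have h : ∀ k x (t : Fin N), (t : ℕ) < k → (A ^ k) x t = 0 := by
    intro k
    induction k with
    | zero => intro x t ht; omega
    | succ k ih =>
      intro x t ht
      rw [pow_succ', Module.End.mul_apply]
      exact hA _ _ fun s hs => ih x s (by have : (s : ℕ) < t := hs; omega)
  exact ⟨N, LinearMap.ext fun x => funext fun t => h N x t t.2⟩

lemma isNilpotent_outputMap_comp_controlMap (H : ℕ → Matrix (Fin p) (Fin m) ℝ)
    (K : ℕ → Matrix (Fin m) (Fin p) ℝ) (N : ℕ) :
    IsNilpotent (outputMap H N ∘ₗ controlMap K N) := by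
  refine isNilpotent_of_strictlyCausal fun x t hx => ?_
  rw [LinearMap.comp_apply, outputMap_apply]
  refine Finset.sum_eq_zero fun s _ => ?_
  split_ifs with hs
  · have : controlMap K N x s = 0 := by
      rw [controlMap_apply]
      refine Finset.sum_eq_zero fun r _ => ?_
      split_ifs with hr
      · rw [hx r (hr.trans_le hs), ← actLin_apply, map_zero]
      · rfl
    rw [this, ← actLin_apply, map_zero]
  · rfl

/-- Strong induction along the recursion. Only `w` and `v` up to time `t` enter, and the σ-algebra
is arbitrary, so the lemma also shows adaptedness to the past. -/
lemma measurable_of_isControlled {Ω : Type*} {mΩ : MeasurableSpace Ω}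
    {H : ℕ → Matrix (Fin p) (Fin m) ℝ} {K : ℕ → Matrix (Fin m) (Fin p) ℝ}
    {w u : ℕ → Ω → EuclideanSpace ℝ (Fin m)} {v : ℕ → Ω → EuclideanSpace ℝ (Fin p)}
    (hu : IsControlled K w (output H u v) u) {t : ℕ} (hw : ∀ s ≤ t, Measurable (w s))
    (hv : ∀ s, 1 ≤ s → s ≤ t → Measurable (v s)) : ∀ s ≤ t, Measurable (u s) := by
  intro s
  induction s using Nat.strong_induction_on with
  | _ s ih =>
    intro hs
    have h : u s = fun ω => ∑ r ∈ Finset.Icc 1 s, act (K (s - r)) (output H u v r ω) + w s ω :=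
      funext fun ω => hu s ω
    rw [h]
    refine Measurable.add (Finset.measurable_fun_sum _ fun r hr => ?_) (hw s hs)
    rw [Finset.mem_Icc] at hr
    refine (measurable_act _).comp (Measurable.add (Finset.measurable_fun_sum _ fun l hl => ?_)
      (hv r hr.1 (hr.2.trans hs)))
    rw [Finset.mem_Icc] at hl
    exact (measurable_act _).comp (ih _ (by omega) (by omega))

end Loop

/-! ### Independence of past inputs and future noise -/

section Independence

variable {Ω : Type*} {mΩ : MeasurableSpace Ω} {P : Measure Ω} [IsProbabilityMeasure P]

/-- The joint law is a triple product measure, and products of measures are associative. -/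
lemma indepFun_prodMk_of_indepFun {α β γ : Type*} {mα : MeasurableSpace α}
    {mβ : MeasurableSpace β} {mγ : MeasurableSpace γ} {X : Ω → α} {Y : Ω → β} {Z : Ω → γ}
    (hX : Measurable X) (hY : Measurable Y) (hZ : Measurable Z)
    (hXYZ : IndepFun X (fun ω => (Y ω, Z ω)) P) (hYZ : IndepFun Y Z P) :
    IndepFun (fun ω => (X ω, Y ω)) Z P := by
  have := Measure.isProbabilityMeasure_map (μ := P) hX.aemeasurable
  have := Measure.isProbabilityMeasure_map (μ := P) hY.aemeasurable
  have := Measure.isProbabilityMeasure_map (μ := P) hZ.aemeasurable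
  have hXY : IndepFun X Y P := hXYZ.comp measurable_id measurable_fst
  rw [indepFun_iff_map_prod_eq_prod_map_map (by fun_prop) (by fun_prop)] at hXYZ hYZ hXY ⊢
  refine MeasurableEquiv.prodAssoc.map_measurableEquiv_injective ?_
  rw [hXY, Measure.prodAssoc_prod, ← hYZ, ← hXYZ, Measure.map_map (by fun_prop) (by fun_prop)]
  rfl

lemma indepFun_past_noise {E F : Type*} {mE : MeasurableSpace E} {mF : MeasurableSpace F}
    {w : ℕ → Ω → E} {v : ℕ → Ω → F} (hw : ∀ t, Measurable (w t)) (hv : ∀ t, Measurable (v t))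
    (hind : iIndepFun v P) (hwv : IndepFun (fun ω t => w t ω) (fun ω t => v (t + 1) ω) P) (t : ℕ) :
    IndepFun (fun ω => ((fun s => w s ω), fun s : Fin t => v (s + 1) ω)) (v (t + 1)) P := by
  refine indepFun_prodMk_of_indepFun (measurable_pi_iff.2 hw)
    (measurable_pi_iff.2 fun s => hv _) (hv _) ?_ ?_
  · exact hwv.comp (φ := id) (ψ := fun x : ℕ → F => ((fun s : Fin t => x s), x t)) measurable_id
      (by fun_prop)
  · have h := hind.indepFun_finset (Finset.Icc 1 t) {t + 1} (by simp) hv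
    have hmem : ∀ s : Fin t, (s : ℕ) + 1 ∈ Finset.Icc 1 t := fun s =>
      Finset.mem_Icc.2 ⟨by omega, s.2⟩
    exact h.comp (φ := fun (x : Finset.Icc 1 t → F) (s : Fin t) => x ⟨s + 1, hmem s⟩)
      (ψ := fun x : ({t + 1} : Finset ℕ) → F => x ⟨t + 1, Finset.mem_singleton_self _⟩)
      (by fun_prop) (by fun_prop)

/-- The input up to time `t` is independent of the noise at time `t + 1`. -/
lemma indepFun_filter_noise {p m : ℕ} {H D : ℕ → Matrix (Fin p) (Fin m) ℝ}
    {K : ℕ → Matrix (Fin m) (Fin p) ℝ} {w u : ℕ → Ω → EuclideanSpace ℝ (Fin m)}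
    {v : ℕ → Ω → EuclideanSpace ℝ (Fin p)} (hw : ∀ t, Measurable (w t))
    (hv : ∀ t, Measurable (v t)) (hind : iIndepFun v P)
    (hwv : IndepFun (fun ω t => w t ω) (fun ω t => v (t + 1) ω) P)
    (hu : IsControlled K w (output H u v) u) (t : ℕ) :
    IndepFun (fun ω => ∑ l ∈ Finset.Icc 1 (t + 1), act (D l) (u (t + 1 - l) ω)) (v (t + 1)) P := by
  have h := indepFun_past_noise hw hv hind hwv t
  set past : Ω → (ℕ → EuclideanSpace ℝ (Fin m)) × (Fin t → EuclideanSpace ℝ (Fin p)) :=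
    fun ω => ((fun s => w s ω), fun s : Fin t => v (s + 1) ω)
  have hpast : Measurable[MeasurableSpace.comap past inferInstance] past :=
    comap_measurable past
  -- The measurability lemma is used for the σ-algebra generated by `past`: inputs up to time `t`
  -- are functions of `w` and of the noise at times `1, …, t`.
  have hum := @measurable_of_isControlled p m Ω (MeasurableSpace.comap past inferInstance) H K w u v
    hu t (fun s _ => ((measurable_pi_apply s).comp measurable_fst).comp hpast) (fun s h1 h2 => by
      obtain ⟨r, rfl⟩ := Nat.exists_eq_add_of_le' h1
      exact ((measurable_pi_apply (⟨r, by omega⟩ : Fin t)).comp measurable_snd).comp hpast)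
  have hsum : Measurable[MeasurableSpace.comap past inferInstance]
      fun ω => ∑ l ∈ Finset.Icc 1 (t + 1), act (D l) (u (t + 1 - l) ω) := by
    refine @Finset.measurable_fun_sum _ _ _ _ _ _ (MeasurableSpace.comap past inferInstance) _ _
      fun l hl => ?_
    rw [Finset.mem_Icc] at hl
    exact (measurable_act _).comp (hum _ (by omega))
  rw [IndepFun_iff_Indep] at h ⊢
  exact indep_of_indep_of_le_left h hsum.comap_le

end Independence

/-! ### Gaussian divergence -/

section Quadratic

lemma quadForm_add_sub {p : ℕ} (A : Matrix (Fin p) (Fin p) ℝ) (x z : Fin p → ℝ) :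
    (x + z) ⬝ᵥ A *ᵥ (x + z) - x ⬝ᵥ A *ᵥ x =
      z ⬝ᵥ A *ᵥ z + ∑ i, ∑ j, A i j * (x i * z j + z i * x j) := by
  simp only [dotProduct, Matrix.mulVec, Finset.mul_sum, Pi.add_apply]
  rw [← Finset.sum_sub_distrib, ← Finset.sum_add_distrib]
  refine Finset.sum_congr rfl fun i _ => ?_
  rw [← Finset.sum_sub_distrib, ← Finset.sum_add_distrib]
  exact Finset.sum_congr rfl fun j _ => by ring

lemma quadForm_le_frobNorm {p : ℕ} (A : Matrix (Fin p) (Fin p) ℝ) (z : EuclideanSpace ℝ (Fin p)) :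
    z.ofLp ⬝ᵥ A *ᵥ z.ofLp ≤ frobNorm A * ‖z‖ ^ 2 := by
  have h := norm_sum_bilin_le_frobNorm A (x := z.ofLp) (y := z.ofLp) fun _ => rfl
  rw [EuclideanSpace.norm_sq_eq]
  refine le_trans (le_of_eq ?_) ((le_abs_self _).trans h)
  simp only [dotProduct, Matrix.mulVec, Finset.mul_sum]
  exact Finset.sum_congr rfl fun i _ => Finset.sum_congr rfl fun j _ => by ring

variable {Ω : Type*} {mΩ : MeasurableSpace Ω} {P : Measure Ω} {p : ℕ}

lemma integrable_quadForm (A : Matrix (Fin p) (Fin p) ℝ) {Z : Ω → EuclideanSpace ℝ (Fin p)}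
    (hZ : MemLp Z 2 P) : Integrable (fun ω => (Z ω).ofLp ⬝ᵥ A *ᵥ (Z ω).ofLp) P := by
  have hZi : ∀ i, MemLp (fun ω => Z ω i) 2 P := fun i =>
    (EuclideanSpace.proj (𝕜 := ℝ) i).comp_memLp' hZ
  have h : (fun ω => (Z ω).ofLp ⬝ᵥ A *ᵥ (Z ω).ofLp) =
      fun ω => ∑ i, ∑ j, A i j * (Z ω i * Z ω j) := by
    ext ω
    simp only [dotProduct, Matrix.mulVec, Finset.mul_sum]
    exact Finset.sum_congr rfl fun i _ => Finset.sum_congr rfl fun j _ => by ring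
  rw [h]
  exact integrable_finsetSum _ fun i _ => integrable_finsetSum _ fun j _ =>
    ((hZi i).integrable_mul (hZi j)).const_mul _

/-- For a centred noise `X` and an independent shift `Z`, the cross terms vanish. -/
lemma integral_quadForm_add_sub_le [IsProbabilityMeasure P] (A : Matrix (Fin p) (Fin p) ℝ)
    {X Z : Ω → EuclideanSpace ℝ (Fin p)} (hX : MemLp X 2 P) (hZ : MemLp Z 2 P)
    (hZX : IndepFun Z X P) (hX0 : ∫ ω, X ω ∂P = 0) :
    ∫ ω, ((X ω + Z ω).ofLp ⬝ᵥ A *ᵥ (X ω + Z ω).ofLp - (X ω).ofLp ⬝ᵥ A *ᵥ (X ω).ofLp) ∂P ≤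
      frobNorm A * ∫ ω, ‖Z ω‖ ^ 2 ∂P := by
  have hXi : ∀ i, MemLp (fun ω => X ω i) 2 P := fun i =>
    (EuclideanSpace.proj (𝕜 := ℝ) i).comp_memLp' hX
  have hZi : ∀ i, MemLp (fun ω => Z ω i) 2 P := fun i =>
    (EuclideanSpace.proj (𝕜 := ℝ) i).comp_memLp' hZ
  have hX0i : ∀ i, ∫ ω, X ω i ∂P = 0 := by
    intro i
    have h := (EuclideanSpace.proj (𝕜 := ℝ) i).integral_comp_comm
      (hX.integrable (by norm_num : (1 : ℝ≥0∞) ≤ 2))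
    rw [hX0, map_zero] at h
    exact h
  have hcross : ∀ i j, ∫ ω, Z ω i * X ω j ∂P = 0 := by
    intro i j
    have hind : IndepFun (fun ω => Z ω i) (fun ω => X ω j) P :=
      hZX.comp (φ := fun x : EuclideanSpace ℝ (Fin p) => x i)
        (ψ := fun x : EuclideanSpace ℝ (Fin p) => x j) (by fun_prop) (by fun_prop)
    rw [hind.integral_fun_mul_eq_mul_integral (hZi i).1 (hXi j).1, hX0i, mul_zero]
  have hcross' : ∀ i j, ∫ ω, X ω i * Z ω j ∂P = 0 := by
    intro i j
    simp only [mul_comm (X _ _)]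
    exact hcross j i
  have hXZ : ∀ i j, Integrable (fun ω => X ω i * Z ω j) P := fun i j =>
    (hXi i).integrable_mul (hZi j)
  have hZX' : ∀ i j, Integrable (fun ω => Z ω i * X ω j) P := fun i j =>
    (hZi i).integrable_mul (hXi j)
  have hsum : ∀ i j, Integrable (fun ω => A i j * (X ω i * Z ω j + Z ω i * X ω j)) P :=
    fun i j => ((hXZ i j).add (hZX' i j)).const_mul _
  simp only [WithLp.ofLp_add, quadForm_add_sub]
  rw [integral_add (integrable_quadForm A hZ) (integrable_finsetSum _ fun i _ =>
    integrable_finsetSum _ fun j _ => hsum i j), integral_finsetSum _ fun i _ =>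
    integrable_finsetSum _ fun j _ => hsum i j]
  have hzero : ∀ i, ∫ ω, ∑ j, A i j * (X ω i * Z ω j + Z ω i * X ω j) ∂P = 0 := by
    intro i
    rw [integral_finsetSum _ fun j _ => hsum i j]
    refine Finset.sum_eq_zero fun j _ => ?_
    rw [integral_const_mul, integral_add (hXZ i j) (hZX' i j), hcross, hcross', add_zero, mul_zero]
  simp only [hzero, Finset.sum_const_zero, add_zero]
  rw [← integral_const_mul]
  exact integral_mono (integrable_quadForm A hZ) (hZ.integrable_norm_pow (by norm_num) |>.const_mul _)
    fun ω => quadForm_le_frobNorm A (Z ω)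

end Quadratic

/-! ### Divergence of the joint input-output laws -/

section Joint

variable {Ω : Type*} {mΩ : MeasurableSpace Ω} {P : Measure Ω} {p m : ℕ}

lemma memLp_two_of_map_eq_multivariateGaussian {S : Matrix (Fin p) (Fin p) ℝ}
    {X : Ω → EuclideanSpace ℝ (Fin p)} (hX : Measurable X)
    (hlaw : P.map X = multivariateGaussian 0 S) : MemLp X 2 P := by
  have h : MemLp id 2 (P.map X) := by
    rw [hlaw]
    exact IsGaussian.memLp_two_id
  exact (memLp_map_measure_iff h.1 hX.aemeasurable).1 h

lemma integral_eq_zero_of_map_eq_multivariateGaussian {S : Matrix (Fin p) (Fin p) ℝ}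
    {X : Ω → EuclideanSpace ℝ (Fin p)} (hX : Measurable X)
    (hlaw : P.map X = multivariateGaussian 0 S) : ∫ ω, X ω ∂P = 0 := by
  have h : ∫ x, x ∂(P.map X) = ∫ ω, X ω ∂P :=
    integral_map hX.aemeasurable measurable_id.aestronglyMeasurable
  rw [← h, hlaw, integral_id_multivariateGaussian]

lemma measurable_sum_quadForm (A : Matrix (Fin p) (Fin p) ℝ) (N : ℕ) :
    Measurable fun x : Fin N → EuclideanSpace ℝ (Fin p) =>
      ∑ t, (x t).ofLp ⬝ᵥ A *ᵥ (x t).ofLp := by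
  simp only [dotProduct, Matrix.mulVec]
  fun_prop

variable [IsProbabilityMeasure P] {S : Matrix (Fin p) (Fin p) ℝ}
  {v : ℕ → Ω → EuclideanSpace ℝ (Fin p)}
  {w : ℕ → Ω → EuclideanSpace ℝ (Fin m)} {K : ℕ → Matrix (Fin m) (Fin p) ℝ}

/-- The joint law of the inputs and outputs of a controlled system on a finite horizon. -/
lemma map_output_eq_withDensity (hv : ∀ t, Measurable (v t)) (hw : ∀ t, Measurable (w t))
    (hwv : IndepFun (fun ω t => w t ω) (fun ω t => v (t + 1) ω) P)
    {H : ℕ → Matrix (Fin p) (Fin m) ℝ} {u : ℕ → Ω → EuclideanSpace ℝ (Fin m)}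
    (hu : IsControlled K w (output H u v) u) {N : ℕ}
    {g : (Fin N → EuclideanSpace ℝ (Fin p)) → ℝ≥0∞} (hg : Measurable g)
    (hlaw : P.map (fun ω (t : Fin N) => v (t + 1) ω) = volume.withDensity g) :
    P.map (fun ω => ((fun t : Fin N => u t ω), fun t : Fin N => output H u v (t + 1) ω)) =
      (((P.map fun ω (t : Fin N) => w t ω).prod volume).map
        fun x => (controlMap K N x.2 + x.1, x.2)).withDensity
          fun x => g (x.2 - outputMap H N x.1) := by
  refine map_closedLoop_eq_withDensity volume (measurable_pi_iff.2 fun t => hv _)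
    (measurable_pi_iff.2 fun t => hw _)
    (hwv.comp (φ := fun (x : ℕ → EuclideanSpace ℝ (Fin m)) (t : Fin N) => x t)
      (ψ := fun (x : ℕ → EuclideanSpace ℝ (Fin p)) (t : Fin N) => x t) (by fun_prop) (by fun_prop))
    (isNilpotent_outputMap_comp_controlMap H K N) hg hlaw (fun ω => funext fun t => ?_)
    fun ω => funext fun t => ?_
  · rw [Pi.add_apply, controlMap_seq K N fun s => output H u v s ω]
    exact hu t ω
  · rw [Pi.add_apply, outputMap_seq H N fun s => u s ω]
    rfl

/-- The divergence between the joint laws of the inputs and outputs of two plants with the same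
controller. -/
lemma klDiv_joint_le (hS : S.PosDef) (hv : ∀ t, Measurable (v t)) (hind : iIndepFun v P)
    (hlaw : ∀ t, P.map (v t) = multivariateGaussian 0 S) (hw : ∀ t, Measurable (w t))
    (hwv : IndepFun (fun ω t => w t ω) (fun ω t => v (t + 1) ω) P)
    {H H' : ℕ → Matrix (Fin p) (Fin m) ℝ} {u u' : ℕ → Ω → EuclideanSpace ℝ (Fin m)}
    (hu : IsControlled K w (output H u v) u) (hu' : IsControlled K w (output H' u' v) u')
    (hu2 : ∀ t, MemLp (u t) 2 P) (N : ℕ) :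
    klDiv (P.map fun ω => ((fun t : Fin N => u t ω), fun t : Fin N => output H u v (t + 1) ω))
      (P.map fun ω => ((fun t : Fin N => u' t ω), fun t : Fin N => output H' u' v (t + 1) ω)) ≤
      ENNReal.ofReal (frobNorm S⁻¹ / 2 * ∑ t : Fin N,
        ∫ ω, ‖∑ l ∈ Finset.Icc 1 ((t : ℕ) + 1), act (H l - H' l) (u (t + 1 - l) ω)‖ ^ 2 ∂P) := by
  obtain ⟨c, hc, hd⟩ := exists_map_noise_eq_withDensity hS (v := fun t : Fin N => v (t + 1))
    (fun t => hv _) (fun t => hlaw _)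
    (hind.precomp (g := fun t : Fin N => (t : ℕ) + 1) fun a b h => Fin.ext (by simpa using h))
  set q : (Fin N → EuclideanSpace ℝ (Fin p)) → ℝ :=
    fun x => ∑ t, (x t).ofLp ⬝ᵥ S⁻¹ *ᵥ (x t).ofLp with hq
  have hqm : Measurable q := measurable_sum_quadForm S⁻¹ N
  have hgm : Measurable fun x => ENNReal.ofReal (c * Real.exp (-(q x) / 2)) := by fun_prop
  have hum : ∀ t, Measurable (u t) := fun t =>
    measurable_of_isControlled hu (fun s _ => hw s) (fun s _ _ => hv s) t le_rfl
  have hum' : ∀ t, Measurable (u' t) := fun t =>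
    measurable_of_isControlled hu' (fun s _ => hw s) (fun s _ _ => hv s) t le_rfl
  have hout : ∀ (G : ℕ → Matrix (Fin p) (Fin m) ℝ) (x : ℕ → Ω → EuclideanSpace ℝ (Fin m)),
      (∀ t, Measurable (x t)) → ∀ t, Measurable (output G x v t) := fun G x hx t =>
    (Finset.measurable_fun_sum _ fun l _ => (measurable_act _).comp (hx _)).add (hv t)
  have hz : Measurable fun ω => ((fun t : Fin N => u t ω), fun t : Fin N =>
      output H u v (t + 1) ω) :=
    (measurable_pi_iff.2 fun t => hum _).prodMk (measurable_pi_iff.2 fun t => hout H u hum _)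
  have hz' : Measurable fun ω => ((fun t : Fin N => u' t ω), fun t : Fin N =>
      output H' u' v (t + 1) ω) :=
    (measurable_pi_iff.2 fun t => hum' _).prodMk (measurable_pi_iff.2 fun t => hout H' u' hum' _)
  have hT : ∀ G : ℕ → Matrix (Fin p) (Fin m) ℝ, Measurable (outputMap G N) := fun G =>
    (outputMap G N).continuous_of_finiteDimensional.measurable
  have hjoint := map_output_eq_withDensity hv hw hwv hu hgm hd
  have hjoint' := map_output_eq_withDensity hv hw hwv hu' hgm hd
  have hP := Measure.isProbabilityMeasure_map (μ := P) hz.aemeasurable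
  have hP' := Measure.isProbabilityMeasure_map (μ := P) hz'.aemeasurable
  -- the log-likelihood ratio along the trajectories of the true system
  set e : ℕ → Ω → EuclideanSpace ℝ (Fin p) := fun t ω =>
    ∑ l ∈ Finset.Icc 1 (t + 1), act (H l - H' l) (u (t + 1 - l) ω) with he
  have he2 : ∀ t, MemLp (e t) 2 P := fun t => memLp_finsetSum _ fun l _ =>
    (LinearMap.toContinuousLinearMap (actLin (H l - H' l))).comp_memLp' (hu2 _)
  have hv2 : ∀ t, MemLp (v t) 2 P := fun t =>
    memLp_two_of_map_eq_multivariateGaussian (hv t) (hlaw t)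
  have hterm : ∀ t ∈ (Finset.univ : Finset (Fin N)), Integrable (fun ω =>
      (v (t + 1) ω + e t ω).ofLp ⬝ᵥ S⁻¹ *ᵥ (v (t + 1) ω + e t ω).ofLp - (v (t + 1) ω).ofLp ⬝ᵥ S⁻¹ *ᵥ (v (t + 1) ω).ofLp) P := fun t _ =>
    (integrable_quadForm S⁻¹ ((hv2 (t + 1)).add (he2 t))).sub
      (integrable_quadForm S⁻¹ (hv2 (t + 1)))
  set f : (Fin N → EuclideanSpace ℝ (Fin m)) × (Fin N → EuclideanSpace ℝ (Fin p)) → ℝ :=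
    fun x => c * Real.exp (-(q (x.2 - outputMap H N x.1)) / 2) with hf
  set f' : (Fin N → EuclideanSpace ℝ (Fin m)) × (Fin N → EuclideanSpace ℝ (Fin p)) → ℝ :=
    fun x => c * Real.exp (-(q (x.2 - outputMap H' N x.1)) / 2) with hf'
  have hfm : Measurable f := by fun_prop
  have hfm' : Measurable f' := by fun_prop
  -- Along true trajectories the residual is `v` for the true plant and `v + e` for the other one;
  -- the normalizing constants cancel.
  have hllr : ∀ ω, Real.log (f ((fun t : Fin N => u t ω), fun t : Fin N =>
        output H u v (t + 1) ω)) -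
      Real.log (f' ((fun t : Fin N => u t ω), fun t : Fin N => output H u v (t + 1) ω)) =
      2⁻¹ * ∑ t : Fin N, ((v (t + 1) ω + e t ω).ofLp ⬝ᵥ S⁻¹ *ᵥ (v (t + 1) ω + e t ω).ofLp -
        (v (t + 1) ω).ofLp ⬝ᵥ S⁻¹ *ᵥ (v (t + 1) ω).ofLp) := by
    intro ω
    have h1 : (fun t : Fin N => output H u v (t + 1) ω) - outputMap H N (fun t => u t ω) =
        fun t : Fin N => v (t + 1) ω := by
      funext t
      rw [Pi.sub_apply, outputMap_seq H N fun s => u s ω, output, add_sub_cancel_left]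
    have h2 : (fun t : Fin N => output H u v (t + 1) ω) - outputMap H' N (fun t => u t ω) =
        fun t : Fin N => v (t + 1) ω + e t ω := by
      funext t
      rw [Pi.sub_apply, outputMap_seq H' N fun s => u s ω, output, he]
      simp only [act_sub, Finset.sum_sub_distrib]
      abel
    simp only [hf, hf', h1, h2]
    rw [Real.log_mul hc.ne' (Real.exp_ne_zero _), Real.log_mul hc.ne' (Real.exp_ne_zero _),
      Real.log_exp, Real.log_exp, Finset.sum_sub_distrib]
    ring
  have hint : Integrable (fun x => Real.log (f x) - Real.log (f' x))
      (P.map fun ω => ((fun t : Fin N => u t ω), fun t : Fin N => output H u v (t + 1) ω)) := by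
    rw [integrable_map_measure (by fun_prop) hz.aemeasurable]
    simp only [Function.comp_def, hllr]
    exact (integrable_finsetSum _ hterm).const_mul _
  have hval : ∫ x, Real.log (f x) - Real.log (f' x)
      ∂(P.map fun ω => ((fun t : Fin N => u t ω), fun t : Fin N => output H u v (t + 1) ω)) ≤
      frobNorm S⁻¹ / 2 * ∑ t : Fin N, ∫ ω, ‖e t ω‖ ^ 2 ∂P := by
    rw [integral_map hz.aemeasurable (by fun_prop)]
    simp only [hllr]
    rw [integral_const_mul, integral_finsetSum _ hterm, Finset.mul_sum,
      Finset.mul_sum]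
    refine Finset.sum_le_sum fun t _ => ?_
    -- `e t` uses inputs up to time `t` and is therefore independent of the noise at time `t + 1`,
    -- even in closed loop.
    have := integral_quadForm_add_sub_le S⁻¹ (hv2 (t + 1)) (he2 t)
      (indepFun_filter_noise hw hv hind hwv hu t)
      (integral_eq_zero_of_map_eq_multivariateGaussian (hv _) (hlaw _))
    linarith
  rw [hjoint] at hP hint hval
  rw [hjoint'] at hP'
  rw [hjoint, hjoint']
  have hkl := klDiv_withDensity_ofReal hfm hfm' (fun x => by positivity) (fun x => by positivity)
    (hP := hP) (hQ := hP') hint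
  exact hkl.trans_le (ENNReal.ofReal_le_ofReal hval)

end Joint

/-! ### Bounds for a single experiment -/

namespace Experiment

variable {D : Set ℂ} {n p m : ℕ} (E : Experiment.{u} D n p m)

lemma precNorm_nonneg : 0 ≤ E.precNorm := frobNorm_nonneg _

lemma psdSup_nonneg : 0 ≤ E.psdSup := ENNReal.toReal_nonneg

lemma rho_nonneg : 0 ≤ E.rho := Real.iSup_nonneg fun _ => norm_nonneg _

lemma norm_pole_le_rho (j : Fin n) : ‖E.pole j‖ ≤ E.rho :=
  le_ciSup (f := fun j => ‖E.pole j‖) (Set.finite_range _).bddAbove j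

/-- Positivity of `a` serves the case of no poles, where the supremum is `0` by convention. -/
lemma rho_lt {a : ℝ} (ha : 0 < a) (h : ∀ z ∈ D, ‖z‖ < a) : E.rho < a := by
  rcases isEmpty_or_nonempty (Fin n) with hn | hn
  · rwa [rho, Real.iSup_of_isEmpty]
  · obtain ⟨j, hj⟩ := exists_eq_ciSup_of_finite (f := fun j => ‖E.pole j‖)
    rw [rho, ← hj]
    exact h _ (E.pole_mem j)

/-- The divergence is bounded by the error of the surrogate in the `H₂` norm. -/
lemma expectedKL_le_h2Norm (hD1 : D ⊆ Metric.ball (0 : ℂ) 1) (N : ℕ) :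
    E.expectedKL N ≤ ENNReal.ofReal (E.precNorm / 2 * (N * (E.psdSup *
      h2Norm (fun z => transferFn (simpleBasis E.pole) E.R z - transferFn E.V E.sR z) ^ 2))) := by
  have hpole : ∀ j, ‖E.pole j‖ < 1 := fun j => norm_lt_one_of_mem hD1 (E.pole_mem j)
  have hspole : ∀ k, ‖E.spole k‖ < 1 := fun k => norm_lt_one_of_mem hD1 (E.spole_minimax.1 k)
  have hu : ∀ t, Measurable (E.u t) := fun t => measurable_of_isControlled E.u_controlled
    (fun s _ => E.w_measurable s) (fun s _ _ => E.v_measurable s) t le_rfl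
  have hsu : ∀ t, Measurable (E.su t) := fun t => measurable_of_isControlled E.su_controlled
    (fun s _ => E.w_measurable s) (fun s _ _ => E.v_measurable s) t le_rfl
  have hout : ∀ (H : ℕ → Matrix (Fin p) (Fin m) ℝ) (x : ℕ → E.Ω → EuclideanSpace ℝ (Fin m)),
      (∀ t, Measurable (x t)) → ∀ t, Measurable (output H x E.v t) := fun H x hx t =>
    (Finset.measurable_fun_sum _ fun l _ => (measurable_act _).comp (hx _)).add (E.v_measurable t)
  refine (lintegral_klDiv_condDistrib_le (measurable_pi_iff.2 fun t => hu _)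
    (measurable_pi_iff.2 fun t => hsu _) (measurable_pi_iff.2 fun t => hout _ _ hu _)
    (measurable_pi_iff.2 fun t => hout _ _ hsu _)).trans ?_
  refine (klDiv_joint_le E.cov_posDef E.v_measurable E.v_indep E.v_law E.w_measurable E.w_indep
    E.u_controlled E.su_controlled E.u_stationary.1 N).trans (ENNReal.ofReal_le_ofReal ?_)
  refine mul_le_mul_of_nonneg_left ?_ (div_nonneg E.precNorm_nonneg zero_le_two)
  refine (Finset.sum_le_card_nsmul _ _ _ fun t _ => ?_).trans_eq
    (by rw [Finset.card_univ, Fintype.card_fin, nsmul_eq_mul])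
  refine (integral_norm_sum_act_sq_le E.u_stationary E.psd_spec E.psd_bounded _
    fun l hl => (Finset.mem_Icc.1 hl).2).trans (mul_le_mul_of_nonneg_left ?_ E.psdSup_nonneg)
  exact sum_frobNorm_realMarkov_sub_sq_le
    (continuous_transferFn (continuous_simpleBasis hpole) _)
    (continuous_transferFn (continuous_basis E.V_basis hspole) _) _

/-- The divergence grows at most linearly in the sample size, with a slope that is governed by
the hyperbolic Chebyshev constant. -/
theorem expectedKL_le (hD : IsCompact D) (hD1 : D ⊆ Metric.ball (0 : ℂ) 1) (N : ℕ) :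
    E.expectedKL N ≤ ENNReal.ofReal
      (E.energy ^ 2 * E.precNorm * E.psdSup / (2 * (1 - E.rho ^ 2)) *
        chebyshevFin D n ^ (2 * n) * N) := by
  refine (E.expectedKL_le_h2Norm hD1 N).trans (ENNReal.ofReal_le_ofReal ?_)
  have hpole : ∀ j, ‖E.pole j‖ < 1 := fun j => norm_lt_one_of_mem hD1 (E.pole_mem j)
  have hC : ∀ j, ∏ k, pdist (E.pole j) (E.spole k) ≤ chebyshevFin D n ^ n := by
    intro j
    -- The pole `j` supplies both `D` nonempty and `n ≠ 0`; without poles there is nothing to prove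
    -- here.
    have : Nonempty D := ⟨⟨_, E.pole_mem j⟩⟩
    rw [chebyshevFin_pow hD1 (Nat.pos_of_ne_zero fun h => (h ▸ j : Fin 0).elim0).ne']
    exact prod_pdist_le_chebyshevProd hD1 hD E.spole_minimax (E.pole_mem j)
  have h := h2Norm_error_sq_le hpole
    (fun k => norm_lt_one_of_mem hD1 (E.spole_minimax.1 k)) E.V_basis E.R E.sR_optimal hC
    E.norm_pole_le_rho (E.rho_lt one_pos fun z hz => norm_lt_one_of_mem hD1 hz)
  refine (mul_le_mul_of_nonneg_left (mul_le_mul_of_nonneg_left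
    (mul_le_mul_of_nonneg_left h E.psdSup_nonneg) N.cast_nonneg)
    (div_nonneg E.precNorm_nonneg zero_le_two)).trans_eq ?_
  rw [mul_comm 2 n, pow_mul, energy]
  simp only [div_eq_mul_inv, mul_inv]
  ring

/-- This division-free form serves both the sample-size bound and the asymptotics, where it also
excludes a vanishing Chebyshev constant. -/
lemma le_of_le_expectedKL (hD : IsCompact D) (hD1 : D ⊆ Metric.ball (0 : ℂ) 1) {N : ℕ} {δ : ℝ}
    (hδ : 0 < δ) (h : ENNReal.ofReal δ ≤ E.expectedKL N) :
    2 * δ * (1 - E.rho ^ 2) ≤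
      E.energy ^ 2 * E.precNorm * E.psdSup * chebyshevFin D n ^ (2 * n) * N := by
  have hρ : 0 < 1 - E.rho ^ 2 := by
    have := E.rho_lt one_pos fun z hz => norm_lt_one_of_mem hD1 hz
    nlinarith [E.rho_nonneg]
  have h1 := (h.trans (E.expectedKL_le hD hD1 N))
  rw [ENNReal.ofReal_le_ofReal_iff', or_iff_left hδ.not_ge, div_mul_eq_mul_div,
    div_mul_eq_mul_div, le_div_iff₀ (by positivity)] at h1
  linarith

/-- The sample size needed to tell the true system from its surrogate. -/
theorem le_sampleSize (hD : IsCompact D) (hD1 : D ⊆ Metric.ball (0 : ℂ) 1) {N : ℕ} {δ : ℝ}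
    (hδ : 0 < δ) (h : ENNReal.ofReal δ ≤ E.expectedKL N) :
    2 * δ * (1 - E.rho ^ 2) / (E.energy ^ 2 * E.precNorm * E.psdSup) *
      (chebyshevFin D n ^ (2 * n))⁻¹ ≤ N := by
  have hκ : 0 ≤ E.energy ^ 2 * E.precNorm * E.psdSup :=
    mul_nonneg (mul_nonneg (sq_nonneg _) E.precNorm_nonneg) E.psdSup_nonneg
  have hτ : 0 ≤ chebyshevFin D n ^ (2 * n) := by
    rw [mul_comm, pow_mul]
    positivity
  rw [div_mul_eq_mul_div, ← div_eq_mul_inv, div_div]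
  refine div_le_of_le_mul₀ (mul_nonneg hτ hκ) N.cast_nonneg ?_
  linarith [E.le_of_le_expectedKL hD hD1 hδ h]

end Experiment

/-! ### Asymptotics of the sample size -/

/-- Sequences with `ε ≤ κₙ τₙ^(2n) Nₙ`, where `κ` grows subexponentially and `τₙ → L`. -/
lemma inv_le_liminf_of_le {κ τ : ℕ → ℝ} {N : ℕ → ℕ} {L ε : ℝ} (hε : 0 < ε)
    (hκ : ∀ r : ℝ, 1 < r → ∀ᶠ n in atTop, κ n ≤ r ^ n) (hτ0 : ∀ n, 0 ≤ τ n)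
    (hτ : Tendsto τ atTop (𝓝 L)) (h : ∀ᶠ n in atTop, ε ≤ κ n * τ n ^ (2 * n) * N n) :
    (ENNReal.ofReal L)⁻¹ ≤ liminf (fun n => (N n : ℝ≥0∞) ^ (1 / (2 * (n : ℝ)))) atTop := by
  refine le_of_forall_lt fun b hb => ?_
  obtain ⟨a, hba, ha⟩ := exists_between hb
  refine hba.trans_le ?_
  have ha0 : 0 < a := bot_le.trans_lt hba
  lift a to NNReal using ha.ne_top
  have ha0' : (0 : ℝ) < a := by exact_mod_cast ha0
  have hL : L < (a : ℝ)⁻¹ := by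
    rw [ENNReal.lt_inv_iff_lt_inv] at ha
    rw [← ENNReal.ofReal_coe_nnreal, ← ENNReal.ofReal_inv_of_pos ha0',
      ENNReal.ofReal_lt_ofReal_iff (by positivity)] at ha
    exact ha
  -- For `L < c < a⁻¹` the ratio `r = (c * a)⁻¹` exceeds one. One factor `r ^ n` absorbs `κ n`, a
  -- second absorbs `ε⁻¹`, and `r ^ (2 * n) * c ^ (2 * n) * a ^ (2 * n) = 1` leaves `a ^ (2 * n) ≤ N
  -- n`.
  obtain ⟨c, hLc, hca⟩ := exists_between hL
  have hc0 : 0 < c := (ge_of_tendsto' hτ hτ0).trans_lt hLc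
  have hca' : c * a < 1 := by rwa [← lt_inv_mul_iff₀' ha0', mul_one]
  have hr : 1 < (c * a)⁻¹ := (one_lt_inv₀ (by positivity)).2 hca'
  refine le_liminf_of_le (by isBoundedDefault) ?_
  filter_upwards [h, hκ _ hr, hτ.eventually_le_const hLc, eventually_ge_atTop 1,
    (tendsto_pow_atTop_atTop_of_one_lt hr).eventually_ge_atTop ε⁻¹] with n hn hκn hτn hn1 hεn
  have hpow : (a : ℝ) ^ (2 * n) ≤ N n := by
    have h1 : ε ≤ (c * a)⁻¹ ^ n * c ^ (2 * n) * N n :=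
      hn.trans (by have := hτ0 n; gcongr)
    have h2 : 1 ≤ (c * a)⁻¹ ^ n * ε := by rwa [← div_le_iff₀ hε, one_div]
    have h3 : (c * a)⁻¹ ^ n * ((c * a)⁻¹ ^ n * c ^ (2 * n)) * a ^ (2 * n) = 1 := by
      rw [pow_mul, pow_mul, ← mul_pow, ← mul_pow, ← mul_pow]
      convert one_pow n
      field_simp
    calc (a : ℝ) ^ (2 * n) = 1 * (a : ℝ) ^ (2 * n) := (one_mul _).symm
      _ ≤ (c * a)⁻¹ ^ n * ((c * a)⁻¹ ^ n * c ^ (2 * n) * N n) * a ^ (2 * n) := by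
        gcongr
        exact h2.trans (by gcongr)
      _ = N n := by linear_combination (N n : ℝ) * h3
  have hpow' : (a : ℝ≥0∞) ^ (2 * n) ≤ N n := by
    have : a ^ (2 * n) ≤ (N n : NNReal) := by exact_mod_cast hpow
    exact_mod_cast this
  rw [one_div, ENNReal.le_rpow_inv_iff (by positivity)]
  exact_mod_cast hpow'

/-- Compactness keeps the spectral radii below a fixed `a < 1`, so the left side of the finite bound
stays above some `ε > 0`. This also forces `chebyshevFin D n` to be nonzero for large `n`, which is
what Fekete's lemma needs. -/
lemma liminf_sampleSize_ge {D : Set ℂ} (hD : IsCompact D) (hD1 : D ⊆ Metric.ball (0 : ℂ) 1)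
    {p m : ℕ → ℕ} (E : ∀ n, Experiment.{u} D n (p n) (m n))
    (hκ : ∀ r : ℝ, 1 < r → ∀ᶠ n in atTop,
      (E n).energy ^ 2 * (E n).precNorm * (E n).psdSup ≤ r ^ n) {δ : ℝ} {N : ℕ → ℕ} (hδ : 0 < δ)
    (h : ∀ᶠ n in atTop, ENNReal.ofReal δ ≤ (E n).expectedKL (N n)) :
    (ENNReal.ofReal (chebyshev D))⁻¹ ≤
      liminf (fun n => (N n : ℝ≥0∞) ^ (1 / (2 * (n : ℝ)))) atTop := by
  have : Nonempty D := ⟨⟨_, (E 1).pole_mem 0⟩⟩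
  have hτ0 : ∀ n, 0 ≤ chebyshevFin D n := fun n => by
    rw [chebyshevFin_eq hD1]
    exact Real.rpow_nonneg (chebyshevProd_nonneg n) _
  obtain ⟨a, ha, ha1⟩ : ∃ a : ℝ, (∀ z ∈ D, ‖z‖ ≤ a) ∧ a < 1 := by
    obtain ⟨z, hz, hmax⟩ := hD.exists_isMaxOn Set.Nonempty.of_subtype continuous_norm.continuousOn
    exact ⟨‖z‖, hmax, norm_lt_one_of_mem hD1 hz⟩
  have hρ : ∀ n, (E (n + 1)).rho ≤ a := fun n => ciSup_le fun j => ha _ ((E (n + 1)).pole_mem j)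
  have ha0 : 0 ≤ a := (E 1).rho_nonneg.trans (hρ 0)
  have hle : ∀ᶠ n in atTop, 2 * δ * (1 - a ^ 2) ≤
      (E n).energy ^ 2 * (E n).precNorm * (E n).psdSup * chebyshevFin D n ^ (2 * n) * N n := by
    filter_upwards [h, eventually_ge_atTop 1] with n hn hn1
    obtain ⟨k, rfl⟩ := Nat.exists_eq_add_of_le' hn1
    refine le_trans ?_ ((E (k + 1)).le_of_le_expectedKL hD hD1 hδ hn)
    have := (E (k + 1)).rho_nonneg
    have := hρ k
    gcongr
  have hε : 0 < 2 * δ * (1 - a ^ 2) := mul_pos (by positivity) (by nlinarith)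
  refine inv_le_liminf_of_le hε hκ hτ0 (tendsto_chebyshevFin hD1
    (chebyshevProd_pos_of_frequently hD1 (Eventually.frequently ?_))) hle
  filter_upwards [hle, eventually_ge_atTop 1] with n hn hn1
  rw [← chebyshevFin_pow hD1 (Nat.one_le_iff_ne_zero.1 hn1)]
  refine pow_pos ((hτ0 n).lt_of_ne' fun h0 => ?_) n
  rw [h0, zero_pow (by lia), mul_zero, zero_mul] at hn
  exact hn.not_gt hε

end OBF

theorem mainTheorem5 (D : Set ℂ) (hD : IsCompact D) (hD1 : D ⊆ Metric.ball (0 : ℂ) 1) :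
    (∀ (n p m : ℕ) (E : OBF.Experiment.{u} D n p m) (N : ℕ),
      E.expectedKL N ≤ ENNReal.ofReal
        (E.energy ^ 2 * E.precNorm * E.psdSup / (2 * (1 - E.rho ^ 2)) *
          OBF.chebyshevFin D n ^ (2 * n) * N) ∧
      ∀ δ : ℝ, 0 < δ → ENNReal.ofReal δ ≤ E.expectedKL N →
        2 * δ * (1 - E.rho ^ 2) / (E.energy ^ 2 * E.precNorm * E.psdSup) *
          (OBF.chebyshevFin D n ^ (2 * n))⁻¹ ≤ N) ∧
    (∀ (p m : ℕ → ℕ) (E : ∀ n, OBF.Experiment.{u} D n (p n) (m n)),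
      (∀ r : ℝ, 1 < r → ∀ᶠ n in Filter.atTop,
        (E n).energy ^ 2 * (E n).precNorm * (E n).psdSup ≤ r ^ n) →
      ∀ (δ : ℝ) (N : ℕ → ℕ), 0 < δ →
        (∀ᶠ n in Filter.atTop, ENNReal.ofReal δ ≤ (E n).expectedKL (N n)) →
        (ENNReal.ofReal (OBF.chebyshev D))⁻¹ ≤
          Filter.liminf (fun n => (N n : ENNReal) ^ (1 / (2 * (n : ℝ)))) Filter.atTop) := by
  exact ⟨fun n p m E N => ⟨E.expectedKL_le hD hD1 N, fun δ hδ h => E.le_sampleSize hD hD1 hδ h⟩,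
    fun p m E hκ δ N hδ h => OBF.liminf_sampleSize_ge hD hD1 E hκ hδ h⟩
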